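/- **Theorem (Aizenman–Lieb monotonicity principle).** For $d\ge 1$ and $\gamma\ge 0$, let $L_{\gamma,d}\in[0,\infty]$ be the optimal (smallest) constant in the Lieb–Thirring inequality $$\sum_{j\ge1}|E_j|^\gamma\le L_{\gamma,d}\int_{\mathbb{R}^d}V(x)_-^{\gamma+d/2}\,\mathrm{d}x\qquad\text{for all real-valued } V\in L^{\gamma+d/2}(\mathbb{R}^d),$$ where $E_1\le E_2\le\dots<0$ are the negative eigenvalues, counted with multiplicity, of the Schrödinger operator $-\Delta+V$ on $L^2(\mathbb{R}^d)$ (defined through its quadratic form $\int|\nabla u|^2+\int V|u|^2$), and $a_-=(|a|-a)/2$. Let $$L^{\mathrm{cl}}_{\gamma,d}=\frac{\Gamma(\gamma+1)}{(4\pi)^{d/2}\,\Gamma(\gamma+\frac d2+1)},\qquad R_{\gamma,d}=\frac{L_{\gamma,d}}{L^{\mathrm{cl}}_{\gamma,d}} .$$ Suppose that $\gamma\ge 1/2$ if $d=1$, $\gamma>0$ if $d=2$, and $\gamma\ge0$ if $d\ge3$. Then for every $\gamma'\ge\gamma$, $$\frac{L_{\gamma',d}}{L^{\mathrm{cl}}_{\gamma',d}}\le\frac{L_{\gamma,d}}{L^{\mathrm{cl}}_{\gamma,d}},\qquad\text{i.e.}\qquad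 R_{\gamma',d}\le R_{\gamma,d}.$$ -/

import Mathlib

open MeasureTheory
open scoped ENNReal LineDeriv ComplexConjugate SchwartzMap

noncomputable section

namespace LiebThirring

/-- Euclidean space `ℝ^d`. -/
abbrev Space (d : ℕ) : Type := EuclideanSpace ℝ (Fin d)

/-- The complex Hilbert space `L²(ℝ^d)`. -/
abbrev L2 (d : ℕ) : Type := Lp ℂ 2 (volume : Measure (Space d))

/-- The inclusion of `L²(ℝ^d)` into the tempered distributions. -/
def toDistribution (d : ℕ) : L2 d →ₗ[ℂ] 𝓢'(Space d, ℂ) :=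
  (Lp.toTemperedDistributionCLM ℂ (volume : Measure (Space d)) 2).toLinearMap

/-- The pairs `(u, g)` in `L²(ℝ^d) × L²(ℝ^d)` such that `g` is the distributional partial
derivative `∂ᵢ u`. -/
def weakPartialGraph (d : ℕ) (i : Fin d) : Submodule ℂ (L2 d × L2 d) :=
  LinearMap.eqLocus
    ((LineDeriv.lineDerivOpCLM ℂ 𝓢'(Space d, ℂ) (EuclideanSpace.single i (1 : ℝ))).toLinearMap ∘ₗ
      toDistribution d ∘ₗ LinearMap.fst ℂ (L2 d) (L2 d))
    (toDistribution d ∘ₗ LinearMap.snd ℂ (L2 d) (L2 d))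

/-- The partial derivative `∂ᵢ` as an unbounded operator in `L²(ℝ^d)`; its domain consists of the
functions in `L²(ℝ^d)` whose distributional derivative `∂ᵢ u` is in `L²(ℝ^d)`. -/
def weakPartial (d : ℕ) (i : Fin d) : L2 d →ₗ.[ℂ] L2 d :=
  (weakPartialGraph d i).toLinearPMap

/-- The Sobolev space `H¹(ℝ^d)` of functions `u ∈ L²(ℝ^d)` with `∇u ∈ L²(ℝ^d)`. -/
def H1 (d : ℕ) : Submodule ℂ (L2 d) :=
  ⨅ i : Fin d, (weakPartial d i).domain

/-- The `i`-th component of the weak gradient of a function in `H¹(ℝ^d)`. -/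
def grad {d : ℕ} (i : Fin d) : H1 d →ₗ[ℂ] L2 d :=
  (weakPartial d i).toFun ∘ₗ Submodule.inclusion (iInf_le _ i)

/-- The form domain of `-Δ + V`: the functions `u ∈ H¹(ℝ^d)` with `∫ |V| |u|² < ∞`. -/
def formDomain {d : ℕ} (V : Space d → ℝ) : Set (H1 d) :=
  {u | Integrable (fun x => (V x : ℂ) * (conj ((u : L2 d) x) * (u : L2 d) x)) volume}

/-- The sesquilinear form `∫ conj (∇φ) · ∇u + ∫ V conj φ u` of `-Δ + V`. -/
def form {d : ℕ} (V : Space d → ℝ) (φ u : H1 d) : ℂ :=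
  (∑ i : Fin d, inner ℂ (grad i φ) (grad i u)) +
    ∫ x, (V x : ℂ) * (conj ((φ : L2 d) x) * (u : L2 d) x)

/-- The pairs `(u, f)` with `u` in the form domain and `form V φ u = ⟪φ, f⟫` for all `φ` in the
form domain, that is, `-Δ u + V u = f` in the weak sense. (The integrability clause is automatic
for measurable `V`, as `2 |V φ u| ≤ |V| |φ|² + |V| |u|²`.) -/
def schrodingerWeakGraph {d : ℕ} (V : Space d → ℝ) : Submodule ℂ (H1 d × L2 d) where
  carrier := {p | p.1 ∈ formDomain V ∧ ∀ φ ∈ formDomain V,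
    Integrable (fun x => (V x : ℂ) * (conj ((φ : L2 d) x) * (p.1 : L2 d) x)) volume ∧
      form V φ p.1 = inner ℂ (φ : L2 d) p.2}
  zero_mem' := by
    have h0 : ((0 : L2 d) : Space d → ℂ) =ᵐ[volume] 0 := Lp.coeFn_zero ℂ 2 volume
    have key : ∀ φ : L2 d, (fun x => (V x : ℂ) * (conj (φ x) * (0 : L2 d) x))
        =ᵐ[volume] fun _ => (0 : ℂ) := fun φ => by
      filter_upwards [h0] with x hx
      rw [hx]; simp
    refine ⟨?_, fun φ _ => ⟨?_, ?_⟩⟩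
    · exact (integrable_zero _ _ _).congr (key 0).symm
    · exact (integrable_zero _ _ _).congr (key φ).symm
    · have := integral_congr_ae (key φ)
      simp only [form, Prod.fst_zero, Prod.snd_zero, map_zero, inner_zero_right,
        Finset.sum_const_zero, zero_add, Submodule.coe_zero]
      rw [this]; simp
  add_mem' := by
    rintro ⟨u, f⟩ ⟨v, g⟩ ⟨hu, hu'⟩ ⟨hv, hv'⟩
    have hadd : (((u + v : H1 d) : L2 d) : Space d → ℂ)
        =ᵐ[volume] fun x => (u : L2 d) x + (v : L2 d) x := Lp.coeFn_add (u : L2 d) (v : L2 d)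
    have key : ∀ φ : L2 d, (fun x => (V x : ℂ) * (conj (φ x) * ((u + v : H1 d) : L2 d) x))
        =ᵐ[volume] fun x => (V x : ℂ) * (conj (φ x) * (u : L2 d) x) +
          (V x : ℂ) * (conj (φ x) * (v : L2 d) x) := fun φ => by
      filter_upwards [hadd] with x hx
      rw [hx]; ring
    refine ⟨?_, fun φ hφ => ⟨?_, ?_⟩⟩
    · refine Integrable.congr
        (((hu' u hu).1.add (hv' u hu).1).add ((hu' v hv).1.add (hv' v hv).1)) ?_
      filter_upwards [hadd] with x hx
      simp only [Pi.add_apply, Prod.mk_add_mk]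
      rw [hx, map_add]; ring
    · exact ((hu' φ hφ).1.add (hv' φ hφ).1).congr (key φ).symm
    · have h1 := (hu' φ hφ).2
      have h2 := (hv' φ hφ).2
      simp only [form, Prod.mk_add_mk, map_add, inner_add_right, Finset.sum_add_distrib] at *
      rw [integral_congr_ae (key φ), integral_add (hu' φ hφ).1 (hv' φ hφ).1, ← h1, ← h2]
      ring
  smul_mem' := by
    rintro c ⟨u, f⟩ ⟨hu, hu'⟩
    have hsm : (((c • u : H1 d) : L2 d) : Space d → ℂ)
        =ᵐ[volume] fun x => c * (u : L2 d) x := Lp.coeFn_smul c (u : L2 d)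
    have key : ∀ φ : L2 d, (fun x => (V x : ℂ) * (conj (φ x) * ((c • u : H1 d) : L2 d) x))
        =ᵐ[volume] fun x => c * ((V x : ℂ) * (conj (φ x) * (u : L2 d) x)) := fun φ => by
      filter_upwards [hsm] with x hx
      rw [hx]; ring
    refine ⟨?_, fun φ hφ => ⟨?_, ?_⟩⟩
    · refine Integrable.congr (hu.const_mul (conj c * c)) ?_
      filter_upwards [hsm] with x hx
      simp only [Prod.smul_mk]
      rw [hx, map_mul]; ring
    · exact ((hu' φ hφ).1.const_mul c).congr (key φ).symm
    · have h1 := (hu' φ hφ).2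
      simp only [form, Prod.smul_mk, map_smul, inner_smul_right] at *
      rw [integral_congr_ae (key φ), integral_const_mul, ← h1, mul_add, Finset.mul_sum]

/-- The Schrödinger operator `-Δ + V` in `L²(ℝ^d)`, as the operator associated with its quadratic
form: `u` is in the domain and `(-Δ + V) u = f ∈ L²(ℝ^d)` iff `u` is in the form domain and
`form V φ u = ⟪φ, f⟫` for every `φ` in the form domain. -/
def schrodingerOperator {d : ℕ} (V : Space d → ℝ) : L2 d →ₗ.[ℂ] L2 d :=
  ((schrodingerWeakGraph V).map
    ((H1 d).subtype.prodMap (LinearMap.id : L2 d →ₗ[ℂ] L2 d))).toLinearPMap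

/-- The eigenspace `{u ∈ dom T | T u = μ u}` of an unbounded operator `T`. -/
def eigenspace {d : ℕ} (T : L2 d →ₗ.[ℂ] L2 d) (μ : ℂ) : Submodule ℂ T.domain :=
  LinearMap.ker (T.toFun - μ • T.domain.subtype)

/-- The multiplicity (dimension of the eigenspace, possibly `0` or `∞`) of the real number `E` as an
eigenvalue of `T`. -/
def eigenvalueMultiplicity {d : ℕ} (T : L2 d →ₗ.[ℂ] L2 d) (E : ℝ) : ℕ∞ :=
  Cardinal.toENat (Module.rank ℂ (eigenspace T (E : ℂ)))

/-- The sum `∑ⱼ |Eⱼ|^γ` over the negative eigenvalues `Eⱼ` of `-Δ + V`, each repeated according to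
its multiplicity. -/
def eigenvalueSum {d : ℕ} (γ : ℝ) (V : Space d → ℝ) : ℝ≥0∞ :=
  ∑' E : Set.Iio (0 : ℝ),
    (eigenvalueMultiplicity (schrodingerOperator V) (E : ℝ) : ℝ≥0∞) * ENNReal.ofReal (|(E : ℝ)| ^ γ)

/-- The optimal constant `L_{γ,d}`: the smallest `L ∈ [0, ∞]` with
`∑ⱼ |Eⱼ|^γ ≤ L ∫ V_-^{γ + d/2}` for all real-valued `V ∈ L^{γ + d/2}(ℝ^d)`. -/
def optimalConstant (γ : ℝ) (d : ℕ) : ℝ≥0∞ :=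
  sInf {L : ℝ≥0∞ | ∀ V : Space d → ℝ,
    MemLp V (ENNReal.ofReal (γ + (d : ℝ) / 2)) volume →
      eigenvalueSum γ V ≤ L * ∫⁻ x, ENNReal.ofReal ((V x)⁻ ^ (γ + (d : ℝ) / 2))}

/-- The semiclassical constant `Γ(γ + 1) / ((4π)^{d/2} Γ(γ + d/2 + 1))`. -/
def classicalConstant (γ : ℝ) (d : ℕ) : ℝ :=
  Real.Gamma (γ + 1) /
    ((4 * Real.pi) ^ ((d : ℝ) / 2) * Real.Gamma (γ + (d : ℝ) / 2 + 1))

/-- The quotient `R_{γ,d} = L_{γ,d} / L_{γ,d}^{cl}`. -/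
def ratio (γ : ℝ) (d : ℕ) : ℝ≥0∞ :=
  optimalConstant γ d / ENNReal.ofReal (classicalConstant γ d)

/-- The parameters of the Lieb–Thirring inequality: `d ≥ 1`, `γ ≥ 0`, with `γ ≥ 1/2` if `d = 1` and
`γ > 0` if `d = 2`. -/
def Admissible (γ : ℝ) (d : ℕ) : Prop :=
  1 ≤ d ∧ 0 ≤ γ ∧ (d = 1 → 1 / 2 ≤ γ) ∧ (d = 2 → 0 < γ)

end LiebThirring

end

noncomputable section

namespace LiebThirring

open scoped FourierTransform
open Filter Topology

/-! Write s = γ' - γ > 0. For a ≥ 0 the Beta integral gives a^(s+q) B(s, q+1) = ∫_0^∞ τ^(s-1)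
(a-τ)_+^q dτ (`lintegral_rpow_mul_indicator`). With a = |E_j| and q = γ it turns ∑ |E_j|^γ' into a
weighted integral over τ of ∑ (|E_j|-τ)_+^γ. With a = V_-(x) and q = γ + d/2 it turns the integrals
of (V+τ)_-^(γ+d/2) back into one of V_-^(γ'+d/2), because (V+τ)_- = (V_- - τ)_+ for τ > 0. The link
between the two is that V + τ ≥ -(V+τ)_-: by the variational principle the negative levels E_j + τ
of -Δ + V + τ lie above those of -Δ - (V+τ)_-, to which the inequality with exponent γ applies
(`sum_shifted_rpow_le`). The quotient of the two Beta factors is exactly the quotient of the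
semiclassical constants (`beta_mul_classicalConstant`).

The analytic work is in this comparison. The variational principle
(`IsBoundedOn.sum_rpow_le_eigenvalueSum`) is proved only for bounded potentials vanishing outside a
set of finite measure: there the form domain is all of H¹, and Rellich's theorem yields minimisers,
hence eigenfunctions. The potential -(V+τ)_- is reached through truncations of this kind; on the
span of finitely many eigenfunctions of -Δ + V the truncation error tends to 0 by dominated
convergence. Of -Δ + V itself only finite orthonormal families of weak eigenfunctions are used
(`eigenvalueSum_le`), so neither self-adjointness nor discreteness of its negative spectrum has to
be known. -/

/-! ### Weak derivatives, H¹ and the Fourier transform on L². -/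

lemma toDistribution_injective (d : ℕ) : Function.Injective (toDistribution d) :=
  LinearMap.ker_eq_bot.1 (Lp.ker_toTemperedDistributionCLM_eq_bot (F := ℂ)
    (μ := (volume : Measure (Space d))) (p := 2))

lemma mem_weakPartialGraph {d : ℕ} {i : Fin d} {u g : L2 d} :
    (u, g) ∈ weakPartialGraph d i ↔
      ∂_{EuclideanSpace.single i (1 : ℝ)} (toDistribution d u) = toDistribution d g := by
  rfl

/-- `Submodule.toLinearPMap` has the prescribed graph only for functional relations. Here this
follows from the injectivity of L² into the tempered distributions. -/
lemma weakPartialGraph_functional {d : ℕ} {i : Fin d} (p : L2 d × L2 d)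
    (hp : p ∈ weakPartialGraph d i) (h0 : p.1 = 0) : p.2 = 0 := by
  obtain ⟨u, g⟩ := p
  simp only at h0
  subst h0
  have h := mem_weakPartialGraph.1 hp
  refine toDistribution_injective d ?_
  rw [← h, map_zero]
  exact (LineDeriv.lineDerivOpCLM ℂ 𝓢'(Space d, ℂ) (EuclideanSpace.single i (1 : ℝ))).map_zero

lemma mem_weakPartial_domain {d : ℕ} {i : Fin d} {u : L2 d} :
    u ∈ (weakPartial d i).domain ↔ ∃ g, (u, g) ∈ weakPartialGraph d i := by
  simp [weakPartial, Submodule.toLinearPMap_domain]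

lemma mem_H1 {d : ℕ} {u : L2 d} :
    u ∈ H1 d ↔ ∀ i, ∃ g, (u, g) ∈ weakPartialGraph d i := by
  simp [H1, Submodule.mem_iInf, mem_weakPartial_domain]

lemma grad_mem_graph {d : ℕ} (i : Fin d) (u : H1 d) :
    ((u : L2 d), grad i u) ∈ weakPartialGraph d i :=
  Submodule.mem_graph_toLinearPMap weakPartialGraph_functional
    (Submodule.inclusion (iInf_le _ i) u : (weakPartial d i).domain)

lemma grad_eq_of_mem {d : ℕ} {i : Fin d} {u : H1 d} {g : L2 d}
    (h : ((u : L2 d), g) ∈ weakPartialGraph d i) : grad i u = g := by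
  refine toDistribution_injective d ?_
  rw [← mem_weakPartialGraph.1 h, ← mem_weakPartialGraph.1 (grad_mem_graph i u)]

lemma isClosed_weakPartialGraph (d : ℕ) (i : Fin d) :
    IsClosed (weakPartialGraph d i : Set (L2 d × L2 d)) := by
  have h : (weakPartialGraph d i : Set (L2 d × L2 d)) =
      {p | (LineDeriv.lineDerivOpCLM ℂ 𝓢'(Space d, ℂ) (EuclideanSpace.single i (1 : ℝ)))
        (Lp.toTemperedDistributionCLM ℂ (volume : Measure (Space d)) 2 p.1) =
        Lp.toTemperedDistributionCLM ℂ (volume : Measure (Space d)) 2 p.2} := rfl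
  rw [h]
  exact isClosed_eq (by fun_prop) (by fun_prop)

/-- `H¹` is complete: the weak gradient is closed. -/
lemma exists_H1_of_tendsto {d : ℕ} {ι : Type*} {l : Filter ι} [l.NeBot] {u : ι → H1 d} {v : L2 d}
    {g : Fin d → L2 d} (hu : Tendsto (fun n => (u n : L2 d)) l (𝓝 v))
    (hg : ∀ i, Tendsto (fun n => grad i (u n)) l (𝓝 (g i))) :
    ∃ w : H1 d, (w : L2 d) = v ∧ ∀ i, grad i w = g i := by
  have hmem : ∀ i, (v, g i) ∈ weakPartialGraph d i := fun i =>
    (isClosed_weakPartialGraph d i).mem_of_tendsto (hu.prodMk_nhds (hg i))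
      (Eventually.of_forall fun n => grad_mem_graph i (u n))
  exact ⟨⟨v, mem_H1.2 fun i => ⟨g i, hmem i⟩⟩, rfl, fun i => grad_eq_of_mem (hmem i)⟩

lemma toLp_mem_H1 {d : ℕ} (f : 𝓢(Space d, ℂ)) : f.toLp 2 volume ∈ H1 d := by
  refine mem_H1.2 fun i =>
    ⟨(∂_{EuclideanSpace.single i (1 : ℝ)} f : 𝓢(Space d, ℂ)).toLp 2 volume,
      mem_weakPartialGraph.2 ?_⟩
  change ∂_{EuclideanSpace.single i (1 : ℝ)} (Lp.toTemperedDistribution (f.toLp 2 volume)) =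
    Lp.toTemperedDistribution (SchwartzMap.toLp _ 2 volume)
  rw [Lp.toTemperedDistribution_toLp_eq, Lp.toTemperedDistribution_toLp_eq,
    TemperedDistribution.lineDerivOp_toTemperedDistributionCLM_eq]

lemma dense_H1 (d : ℕ) : Dense (H1 d : Set (L2 d)) := by
  have h : DenseRange (SchwartzMap.toLpCLM ℂ (E := Space d) ℂ 2 volume) :=
    SchwartzMap.denseRange_toLpCLM ENNReal.ofNat_ne_top
  refine h.mono ?_
  rintro _ ⟨f, rfl⟩
  exact toLp_mem_H1 f

lemma ae_eq_of_forall_integral_schwartz {d : ℕ} {f g : Space d → ℂ}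
    (hf : LocallyIntegrable f) (hg : LocallyIntegrable g)
    (h : ∀ φ : 𝓢(Space d, ℂ), ∫ x, φ x * f x = ∫ x, φ x * g x) : f =ᵐ[volume] g := by
  refine ae_eq_of_integral_contDiff_smul_eq hf hg fun φ φ_smooth φ_cpt => ?_
  have hg₁ : HasCompactSupport (Complex.ofRealCLM ∘ φ) := φ_cpt.comp_left rfl
  have hg₂ : ContDiff ℝ (⊤ : ℕ∞) (Complex.ofRealCLM ∘ φ) := by fun_prop
  simpa using h (hg₁.toSchwartzMap hg₂)

/-- The identity holds for tempered distributions; testing against Schwartz functions identifies the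
two locally integrable representatives. It supplies the high-frequency decay in Rellich's theorem.
-/
lemma fourier_grad {d : ℕ} (i : Fin d) (u : H1 d) :
    (𝓕 (grad i u) : L2 d) =ᵐ[volume]
      fun ξ => 2 * Real.pi * Complex.I * (ξ i : ℂ) * (𝓕 (u : L2 d) : L2 d) ξ := by
  have h : 𝓕 (∂_{EuclideanSpace.single i (1 : ℝ)} (toDistribution d u)) =
      𝓕 (toDistribution d (grad i u)) :=
    congrArg _ (mem_weakPartialGraph.1 (grad_mem_graph i u))
  rw [TemperedDistribution.fourier_lineDerivOp_eq] at h
  change _ • TemperedDistribution.smulLeftCLM ℂ _ (𝓕 (Lp.toTemperedDistribution (u : L2 d))) =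
    𝓕 (Lp.toTemperedDistribution (grad i u)) at h
  rw [Lp.fourier_toTemperedDistribution_eq, Lp.fourier_toTemperedDistribution_eq] at h
  have loc : ∀ f : L2 d, LocallyIntegrable (f : Space d → ℂ) := fun f =>
    (Lp.memLp f).locallyIntegrable (by norm_num)
  have hc : Continuous fun ξ : Space d => 2 * Real.pi * Complex.I * (ξ i : ℂ) := by fun_prop
  refine ae_eq_of_forall_integral_schwartz (loc _) ?_ fun φ => ?_
  · have := (loc (𝓕 (u : L2 d))).smul_continuous hc
    simpa only [smul_eq_mul, mul_comm] using this
  · have h2 := DFunLike.congr_fun h φ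
    have ht : (fun x : Space d => (inner ℝ x (EuclideanSpace.single i (1 : ℝ)) : ℝ) |>
      fun r => (r : ℂ)).HasTemperateGrowth := by fun_prop
    rw [Lp.toTemperedDistribution_apply] at h2
    simp only [smul_eq_mul] at h2
    rw [← h2]
    change (2 * Real.pi * Complex.I) • (TemperedDistribution.smulLeftCLM ℂ _ _) φ = _
    rw [TemperedDistribution.smulLeftCLM_apply_apply, Lp.toTemperedDistribution_apply,
      smul_eq_mul, ← integral_const_mul]
    refine integral_congr_ae (Eventually.of_forall fun x => ?_)
    simp only [SchwartzMap.smulLeftCLM_apply_apply ht]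
    simp [EuclideanSpace.inner_single_right]
    ring

/-- On `L¹ ∩ L²` the inverse Fourier transform of `L²` is given by the integral. -/
lemma fourierInv_ae_eq {d : ℕ} (f : L2 d) (hf : Integrable (f : Space d → ℂ)) :
    (𝓕⁻ f : L2 d) =ᵐ[volume] 𝓕⁻ (f : Space d → ℂ) := by
  have hL : Continuous fun p : Space d × Space d => (-innerₗ (Space d)) p.1 p.2 := by
    simp only [LinearMap.neg_apply, innerₗ_apply_apply]; fun_prop
  have hc : Continuous (𝓕⁻ (f : Space d → ℂ)) :=
    VectorFourier.fourierIntegral_continuous Real.continuous_fourierChar hL hf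
  refine ae_eq_of_forall_integral_schwartz ((Lp.memLp _).locallyIntegrable (by norm_num))
    hc.locallyIntegrable fun φ => ?_
  have h1 := DFunLike.congr_fun (Lp.fourierInv_toTemperedDistribution_eq f) φ
  rw [Lp.toTemperedDistribution_apply, TemperedDistribution.fourierInv_apply,
    Lp.toTemperedDistribution_apply] at h1
  simp only [smul_eq_mul] at h1
  rw [← h1]
  have h2 := VectorFourier.integral_fourierIntegral_smul_eq_flip (L := -innerₗ (Space d))
    Real.continuous_fourierChar hL (φ.integrable (μ := volume)) hf
  have h3 : (-innerₗ (Space d)).flip = -innerₗ (Space d) := by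
    ext x y; simp [real_inner_comm]
  rw [h3] at h2
  rw [SchwartzMap.fourierInv_coe]
  exact h2

/-! ### Rellich compactness by splitting frequencies. -/

/-- Bounded sequences in a separable Hilbert space have weakly Cauchy subsequences. -/
lemma exists_subseq_tendsto_inner {H : Type*} [NormedAddCommGroup H] [InnerProductSpace ℂ H]
    [CompleteSpace H] [TopologicalSpace.SeparableSpace H] (x : ℕ → H) (C : ℝ)
    (hC : ∀ n, ‖x n‖ ≤ C) :
    ∃ σ : ℕ → ℕ, StrictMono σ ∧ ∀ g : H, Tendsto
      (fun p : ℕ × ℕ => inner ℂ g (x (σ p.1) - x (σ p.2))) (atTop ×ˢ atTop) (𝓝 0) := by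
  obtain ⟨ℓ, -, σ, hσ, hlim⟩ := WeakDual.isSeqCompact_closedBall ℂ H 0 C
    (x := fun n => StrongDual.toWeakDual (InnerProductSpace.toDual ℂ H (x n))) (fun n => by
      simp only [Set.mem_preimage, Metric.mem_closedBall, dist_zero_right]
      simpa using hC n)
  refine ⟨σ, hσ, fun g => ?_⟩
  have h1 : Tendsto (fun n => inner ℂ (x (σ n)) g) atTop (𝓝 (ℓ g)) :=
    ((WeakDual.eval_continuous g).tendsto ℓ).comp hlim
  have h2 := (Complex.continuous_conj.tendsto _).comp
    ((h1.comp tendsto_fst).sub (h1.comp (tendsto_snd (f := (atTop : Filter ℕ)))))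
  simp only [sub_self, map_zero] at h2
  refine h2.congr fun p => ?_
  simp

variable {d : ℕ}

/-- The part of an `L²` function on a measurable set. -/
def restrictTo (S : Set (Space d)) (hS : MeasurableSet S) (f : L2 d) : L2 d :=
  ((Lp.memLp f).indicator hS).toLp _

lemma coeFn_restrictTo (S : Set (Space d)) (hS : MeasurableSet S) (f : L2 d) :
    restrictTo S hS f =ᵐ[volume] S.indicator f := MemLp.coeFn_toLp _

lemma restrictTo_add_compl (S : Set (Space d)) (hS : MeasurableSet S) (f : L2 d) :
    restrictTo S hS f + restrictTo Sᶜ hS.compl f = f := by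
  refine Lp.ext ?_
  filter_upwards [Lp.coeFn_add (restrictTo S hS f) (restrictTo Sᶜ hS.compl f),
    coeFn_restrictTo S hS f, coeFn_restrictTo Sᶜ hS.compl f] with x h1 h2 h3
  rw [h1, Pi.add_apply, h2, h3]
  by_cases hx : x ∈ S <;> simp [hx]

lemma memLp_planeWave (S : Set (Space d)) (hS : MeasurableSet S) (hfin : volume S ≠ ∞)
    (x : Space d) : MemLp (S.indicator fun v => conj (Real.fourierChar (inner ℝ v x) : ℂ)) 2
      (volume : Measure (Space d)) := by
  refine (memLp_indicator_const 2 hS (1 : ℂ) (Or.inr hfin)).mono ?_ (Eventually.of_forall fun v => ?_)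
  · refine AEStronglyMeasurable.indicator (Continuous.aestronglyMeasurable ?_) hS
    have := Real.continuous_fourierChar
    fun_prop
  · by_cases hv : v ∈ S
    · simp only [hv, Set.indicator_of_mem, RCLike.norm_conj, Circle.norm_coe, norm_one, le_refl]
    · simp [hv]

/-- A plane wave truncated to a set of finite measure. -/
def planeWave (S : Set (Space d)) (hS : MeasurableSet S) (hfin : volume S ≠ ∞) (x : Space d) :
    L2 d := (memLp_planeWave S hS hfin x).toLp _

/-- Uniformity in `x` provides a constant majorant for dominated convergence. -/
lemma norm_planeWave (S : Set (Space d)) (hS : MeasurableSet S) (hfin : volume S ≠ ∞)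
    (x : Space d) : ‖planeWave S hS hfin x‖ ≤ ‖planeWave S hS hfin 0‖ := by
  refine Lp.norm_le_norm_of_ae_le ?_
  filter_upwards [(memLp_planeWave S hS hfin x).coeFn_toLp,
    (memLp_planeWave S hS hfin 0).coeFn_toLp] with v h1 h2
  rw [planeWave, planeWave, h1, h2]
  by_cases hv : v ∈ S
  · simp only [hv, Set.indicator_of_mem, RCLike.norm_conj, Circle.norm_coe, le_refl]
  · simp [hv]

/-- Point values of the low-frequency part are pairings with fixed L² vectors, so weak convergence
in frequency space becomes pointwise convergence in `x`. -/
lemma fourierInv_restrictTo (S : Set (Space d)) (hS : MeasurableSet S) (hfin : volume S ≠ ∞)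
    (f : L2 d) : (𝓕⁻ (restrictTo S hS f) : L2 d) =ᵐ[volume]
      fun x => inner ℂ (planeWave S hS hfin x) f := by
  have hint : Integrable (restrictTo S hS f : Space d → ℂ) := by
    refine Integrable.congr ?_ (coeFn_restrictTo S hS f).symm
    rw [integrable_indicator_iff hS]
    have : IsFiniteMeasure (volume.restrict S) := ⟨by simpa using hfin.lt_top⟩
    exact ((Lp.memLp f).restrict S).integrable (by norm_num)
  filter_upwards [fourierInv_ae_eq _ hint] with x hx
  rw [hx, Real.fourierInv_eq, L2.inner_def]
  refine integral_congr_ae ?_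
  filter_upwards [coeFn_restrictTo S hS f, (memLp_planeWave S hS hfin x).coeFn_toLp] with v h1 h2
  rw [h1, planeWave, h2]
  by_cases hv : v ∈ S
  · simp [hv, Circle.smul_def, mul_comm]
  · simp [hv]

/-- Outside the ball, 1 ≤ |ξ|/R ≤ R⁻¹ ∑ |ξ_i|, and each 2π|ξ_i||û| is the modulus of the Fourier
transform of a derivative; Plancherel finishes. -/
lemma norm_restrictTo_fourier_le (R : ℝ) (hR : 0 < R) (u : H1 d) :
    ‖restrictTo (Metric.ball (0 : Space d) R)ᶜ measurableSet_ball.compl (𝓕 (u : L2 d))‖ ≤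
      (2 * Real.pi * R)⁻¹ * ∑ i, ‖grad i u‖ := by
  have hpt : ∀ᵐ ξ : Space d,
      ‖restrictTo (Metric.ball (0 : Space d) R)ᶜ measurableSet_ball.compl (𝓕 (u : L2 d)) ξ‖ ≤
        (2 * Real.pi * R)⁻¹ * ‖∑ i, ‖(𝓕 (grad i u) : L2 d) ξ‖‖ := by
    filter_upwards [coeFn_restrictTo (Metric.ball (0 : Space d) R)ᶜ measurableSet_ball.compl
      (𝓕 (u : L2 d)), ae_all_iff.2 fun i => fourier_grad i u] with ξ h1 h2
    rw [h1, Real.norm_of_nonneg (by positivity)]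
    by_cases hξ : ξ ∈ Metric.ball (0 : Space d) R
    · simp only [Set.mem_compl_iff, hξ, not_true_eq_false, not_false_eq_true,
        Set.indicator_of_notMem, norm_zero]
      positivity
    · rw [Set.indicator_of_mem (by simpa using hξ)]
      simp only [h2, norm_mul, Complex.norm_real, Complex.norm_I, mul_one, Complex.norm_ofNat,
        ← Finset.sum_mul, ← Finset.mul_sum]
      have h3 : R ≤ ∑ i, ‖ξ i‖ := by
        have h4 : R ≤ ‖ξ‖ := by simpa using hξ
        refine h4.trans ?_
        rw [EuclideanSpace.norm_eq]
        refine Real.sqrt_le_left (by positivity) |>.2 ?_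
        exact Finset.sum_sq_le_sq_sum_of_nonneg fun i _ => norm_nonneg _
      rw [Real.norm_of_nonneg Real.pi_pos.le, ← mul_assoc, mul_comm _ (‖_‖)]
      have : (1 : ℝ) ≤ (2 * Real.pi * R)⁻¹ * (2 * Real.pi * ∑ i, ‖ξ i‖) := by
        rw [inv_mul_eq_div, le_div_iff₀ (by positivity), one_mul]
        gcongr
      nlinarith [norm_nonneg ((𝓕 (u : L2 d) : L2 d) ξ)]
  have h1 := eLpNorm_le_mul_eLpNorm_of_ae_le_mul hpt 2
  have h2 : eLpNorm (∑ i : Fin d, fun ξ => ‖(𝓕 (grad i u) : L2 d) ξ‖) 2 volume ≤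
      ∑ i, eLpNorm (fun ξ => ‖(𝓕 (grad i u) : L2 d) ξ‖) 2 volume :=
    eLpNorm_sum_le (fun i _ => (Lp.memLp _).1.norm) (by norm_num)
  have h3 : ∀ i, eLpNorm (fun ξ => ‖(𝓕 (grad i u) : L2 d) ξ‖) 2 volume =
      ENNReal.ofReal ‖grad i u‖ := fun i => by
    rw [eLpNorm_norm, ← Lp.enorm_def, ← ofReal_norm, Lp.norm_fourier_eq]
  simp only [h3] at h2
  rw [← ENNReal.ofReal_sum_of_nonneg (fun i _ => norm_nonneg _), Finset.sum_fn] at h2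
  have h4 := h1.trans (mul_le_mul_right h2 _)
  rw [← ENNReal.ofReal_mul (by positivity), ← Lp.enorm_def, ← ofReal_norm] at h4
  exact (ENNReal.ofReal_le_ofReal_iff (by positivity)).1 h4

lemma eLpNorm_restrict_le (B : Set (Space d)) (R : ℝ) (hR : 0 < R) (u : H1 d) :
    eLpNorm (u : L2 d) 2 (volume.restrict B) ≤
      eLpNorm (fun x => inner ℂ (planeWave (Metric.ball (0 : Space d) R) measurableSet_ball
        measure_ball_lt_top.ne x) (𝓕 (u : L2 d) : L2 d)) 2 (volume.restrict B) +
      ENNReal.ofReal ((2 * Real.pi * R)⁻¹ * ∑ i, ‖grad i u‖) := by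
  set low : L2 d := 𝓕⁻ (restrictTo (Metric.ball (0 : Space d) R) measurableSet_ball
    (𝓕 (u : L2 d))) with hlow
  set high : L2 d := 𝓕⁻ (restrictTo (Metric.ball (0 : Space d) R)ᶜ measurableSet_ball.compl
    (𝓕 (u : L2 d))) with hhigh
  have hsum : (u : L2 d) = low + high := by
    rw [hlow, hhigh, ← FourierTransform.fourierInv_add, restrictTo_add_compl,
      FourierTransform.fourierInv_fourier_eq]
  have h1 : eLpNorm (u : L2 d) 2 (volume.restrict B) =
      eLpNorm ((low : Space d → ℂ) + (high : Space d → ℂ)) 2 (volume.restrict B) := by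
    refine eLpNorm_congr_ae (ae_restrict_of_ae ?_)
    conv_lhs => rw [hsum]
    exact Lp.coeFn_add _ _
  rw [h1]
  refine (eLpNorm_add_le (Lp.memLp low).1.restrict (Lp.memLp high).1.restrict (by norm_num)).trans
    (add_le_add (le_of_eq ?_) ?_)
  · exact eLpNorm_congr_ae (ae_restrict_of_ae (fourierInv_restrictTo _ _ _ _))
  · refine (eLpNorm_mono_measure _ Measure.restrict_le_self).trans ?_
    rw [← Lp.enorm_def, ← ofReal_norm]
    refine ENNReal.ofReal_le_ofReal (le_trans (le_of_eq ?_) (norm_restrictTo_fourier_le R hR u))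
    exact (Lp.fourierTransformₗᵢ (Space d) ℂ).symm.norm_map _

/-- **Rellich's theorem**: bounded sequences in `H¹` have subsequences that are Cauchy in `L²(B)`
for every set `B` of finite measure. -/
lemma exists_subseq_tendsto_eLpNorm_restrict (B : Set (Space d)) (hB : volume B ≠ ∞) (u : ℕ → H1 d)
    (C : ℝ) (hu : ∀ n, ‖(u n : L2 d)‖ ≤ C) (hg : ∀ n i, ‖grad i (u n)‖ ≤ C) :
    ∃ σ : ℕ → ℕ, StrictMono σ ∧ Tendsto (fun p : ℕ × ℕ =>
      eLpNorm ((u (σ p.1) - u (σ p.2) : H1 d) : L2 d) 2 (volume.restrict B))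
        (atTop ×ˢ atTop) (𝓝 0) := by
  have : Fact ((2 : ℝ≥0∞) ≠ ∞) := ⟨by norm_num⟩
  obtain ⟨σ, hσ, hlim⟩ := exists_subseq_tendsto_inner (fun n => (𝓕 (u n : L2 d) : L2 d)) C
    (fun n => by simpa using hu n)
  refine ⟨σ, hσ, ?_⟩
  have hC : 0 ≤ C := (norm_nonneg _).trans (hu 0)
  have hF : ∀ p : ℕ × ℕ, (𝓕 ((u (σ p.1) - u (σ p.2) : H1 d) : L2 d) : L2 d) =
      𝓕 (u (σ p.1) : L2 d) - 𝓕 (u (σ p.2) : L2 d) := fun p =>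
    (Lp.fourierTransformₗᵢ (Space d) ℂ).map_sub _ _
  have hlow : ∀ R : ℝ, Tendsto (fun p : ℕ × ℕ => eLpNorm (fun x => inner ℂ
      (planeWave (Metric.ball (0 : Space d) R) measurableSet_ball measure_ball_lt_top.ne x)
      (𝓕 ((u (σ p.1) - u (σ p.2) : H1 d) : L2 d) : L2 d)) 2 (volume.restrict B))
        (atTop ×ˢ atTop) (𝓝 0) := by
    intro R
    set D : ℝ := ‖planeWave (Metric.ball (0 : Space d) R) measurableSet_ball
      measure_ball_lt_top.ne 0‖ * (2 * C)
    have hb : ∀ (p : ℕ × ℕ) (x : Space d), ‖inner ℂ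
        (planeWave (Metric.ball (0 : Space d) R) measurableSet_ball measure_ball_lt_top.ne x)
        (𝓕 ((u (σ p.1) - u (σ p.2) : H1 d) : L2 d) : L2 d)‖ ≤ D := fun p x => by
      refine (norm_inner_le_norm _ _).trans ?_
      refine mul_le_mul (norm_planeWave _ _ _ _) ?_ (norm_nonneg _) (norm_nonneg _)
      rw [hF]
      refine (norm_sub_le _ _).trans ?_
      rw [Lp.norm_fourier_eq, Lp.norm_fourier_eq]
      linarith [hu (σ p.1), hu (σ p.2)]
    -- The integrand tends to 0 pointwise by weak convergence and is bounded by the constant `D`,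
    -- which is integrable to the square on `B` because `B` has finite measure.
    have h1 : Tendsto (fun p : ℕ × ℕ => ∫⁻ x in B, ‖inner ℂ
      (planeWave (Metric.ball (0 : Space d) R) measurableSet_ball measure_ball_lt_top.ne x)
      (𝓕 ((u (σ p.1) - u (σ p.2) : H1 d) : L2 d) : L2 d)‖ₑ ^ (2 : ℝ)) (atTop ×ˢ atTop)
        (𝓝 (∫⁻ _ in B, 0)) := by
      refine tendsto_lintegral_filter_of_dominated_convergence' (fun _ => ENNReal.ofReal D ^ (2 : ℝ))
        (Eventually.of_forall fun p => ?_) (Eventually.of_forall fun p => ae_of_all _ fun x => ?_)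
        ?_ (ae_of_all _ fun x => ?_)
      · have h2 := fourierInv_restrictTo (Metric.ball (0 : Space d) R) measurableSet_ball
          measure_ball_lt_top.ne (𝓕 ((u (σ p.1) - u (σ p.2) : H1 d) : L2 d))
        exact (((Lp.memLp _).1.congr h2).restrict.enorm).pow_const _
      · gcongr
        rw [← ofReal_norm]
        exact ENNReal.ofReal_le_ofReal (hb p x)
      · simp only [lintegral_const, Measure.restrict_apply_univ]
        exact ENNReal.mul_ne_top (by simp) hB
      · have h2 := (hlim (planeWave (Metric.ball (0 : Space d) R) measurableSet_ball
          measure_ball_lt_top.ne x)).enorm.ennrpow_const 2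
        simp only [enorm_zero, ENNReal.zero_rpow_of_pos two_pos] at h2
        refine h2.congr fun p => ?_
        rw [hF]
    have h3 := h1.ennrpow_const (1 / 2)
    simp only [lintegral_zero, ENNReal.zero_rpow_of_pos (by norm_num : (0 : ℝ) < 1 / 2)] at h3
    refine h3.congr fun p => ?_
    rw [eLpNorm_eq_lintegral_rpow_enorm_toReal (by norm_num) (by norm_num)]
    simp
  rw [ENNReal.tendsto_nhds_zero]
  intro ε hε
  -- The cutoff is fixed before the indices: the tail is O(1/R) uniformly, as each of the `d`
  -- derivatives of a difference has norm at most `2 * C`.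
  obtain ⟨R, hR, hRε⟩ : ∃ R : ℝ, 0 < R ∧
      ENNReal.ofReal ((2 * Real.pi * R)⁻¹ * (d * (2 * C))) ≤ ε / 2 := by
    have h4 : Tendsto (fun R : ℝ => ENNReal.ofReal ((2 * Real.pi * R)⁻¹ * (d * (2 * C)))) atTop
        (𝓝 (ENNReal.ofReal (0 * (d * (2 * C))))) := by
      refine ENNReal.tendsto_ofReal (Tendsto.mul_const _ ?_)
      exact tendsto_inv_atTop_zero.comp (tendsto_id.const_mul_atTop (by positivity))
    rw [zero_mul, ENNReal.ofReal_zero, ENNReal.tendsto_nhds_zero] at h4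
    obtain ⟨R, h5, h6⟩ := ((eventually_gt_atTop 0).and (h4 (ε / 2) (ENNReal.half_pos hε.ne'))).exists
    exact ⟨R, h5, h6⟩
  filter_upwards [(ENNReal.tendsto_nhds_zero.1 (hlow R)) (ε / 2) (ENNReal.half_pos hε.ne')] with p hp
  refine (eLpNorm_restrict_le B R hR _).trans ?_
  rw [← ENNReal.add_halves ε]
  refine add_le_add hp (le_trans (ENNReal.ofReal_le_ofReal ?_) hRε)
  gcongr
  refine (Finset.sum_le_card_nsmul Finset.univ _ (2 * C) fun i _ => ?_).trans (by simp)
  rw [map_sub]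
  refine (norm_sub_le _ _).trans ?_
  linarith [hg (σ p.1) i, hg (σ p.2) i]

/-! ### Hermitian forms. -/

section Hermitian

variable {E : Type*} [AddCommGroup E] [Module ℂ E] (A : E →ₗ⋆[ℂ] E →ₗ[ℂ] ℂ)

/-- Combined with nonnegativity at `x + y`, this controls the form at differences of a minimising
sequence. -/
lemma re_sesq_parallelogram (x y : E) :
    (A (x - y) (x - y)).re + (A (x + y) (x + y)).re = 2 * (A x x).re + 2 * (A y y).re := by
  simp only [map_sub, map_add, LinearMap.sub_apply, LinearMap.add_apply, Complex.sub_re,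
    Complex.add_re]
  ring

/-- Null vectors of a Hermitian form that is nonnegative on a subspace are orthogonal to the
subspace. -/
lemma sesq_eq_zero_of_nonneg (hA : ∀ x y, conj (A x y) = A y x) (Y : Submodule ℂ E)
    (hpos : ∀ y ∈ Y, 0 ≤ (A y y).re) {u : E} (hu : u ∈ Y) (h0 : (A u u).re = 0) {φ : E}
    (hφ : φ ∈ Y) : A φ u = 0 := by
  set c := A φ u with hc
  set a := (A φ φ).re with ha
  have ha0 : 0 ≤ a := hpos φ hφ
  have hexp : ∀ t : ℝ, (A (u - ((t : ℂ) * c) • φ) (u - ((t : ℂ) * c) • φ)).re =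
      -2 * t * Complex.normSq c + t ^ 2 * Complex.normSq c * a := by
    intro t
    have h1 : A u φ = conj c := (hA φ u).symm
    have him : (A φ φ).im = 0 := Complex.conj_eq_iff_im.1 (hA φ φ)
    simp only [map_sub, map_smulₛₗ, LinearMap.sub_apply, LinearMap.smul_apply, smul_eq_mul,
      h1, ← hc, map_mul, Complex.conj_ofReal, RingHom.id_apply]
    simp only [Complex.sub_re, Complex.sub_im, Complex.mul_re, Complex.mul_im, Complex.conj_re, Complex.conj_im,
      Complex.ofReal_re, Complex.ofReal_im, h0, him, ← ha, Complex.normSq_apply]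
    ring
  -- The choice t = 1/(a+1) makes -2t + t²a strictly negative, also when a = 0, so nonnegativity
  -- forces c = 0.
  have h := hpos _ (Y.sub_mem hu (Y.smul_mem (((1 / (a + 1) : ℝ) : ℂ) * c) hφ))
  rw [hexp] at h
  have h2 : -2 * (1 / (a + 1)) * Complex.normSq c + (1 / (a + 1)) ^ 2 * Complex.normSq c * a =
      -(Complex.normSq c * ((a + 2) / (a + 1) ^ 2)) := by
    field_simp; ring
  rw [h2] at h
  have h3 : 0 < (a + 2) / (a + 1) ^ 2 := by positivity
  have h4 : Complex.normSq c ≤ 0 := by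
    by_contra hcon
    push Not at hcon
    have := mul_pos hcon h3
    linarith
  exact Complex.normSq_eq_zero.1 (le_antisymm h4 (Complex.normSq_nonneg c))

end Hermitian

lemma form_conj_symm (V : Space d → ℝ) (φ u : H1 d) :
    conj (form V φ u) = form V u φ := by
  rw [form, form, map_add, map_sum, ← integral_conj]
  congr 1
  · exact Finset.sum_congr rfl fun i _ => inner_conj_symm _ _
  · congr 1; ext x
    simp only [map_mul, Complex.conj_ofReal, Complex.conj_conj]; ring

/-! ### Bounded potentials on sets of finite measure: minimisers and eigenfunctions. -/

/-- A measurable potential that is bounded by `K` on `B` and vanishes outside of `B`, where `B` has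
finite measure. -/
structure IsBoundedOn (W : Space d → ℝ) (B : Set (Space d)) (K : ℝ) : Prop where
  aestronglyMeasurable : AEStronglyMeasurable W volume
  measurableSet : MeasurableSet B
  measure_ne_top : volume B ≠ ∞
  nonneg : 0 ≤ K
  abs_le : ∀ x, |W x| ≤ B.indicator (fun _ => K) x

namespace IsBoundedOn

variable {W : Space d → ℝ} {B : Set (Space d)} {K : ℝ} (hW : IsBoundedOn W B K)
include hW

lemma abs_le' (x : Space d) : |W x| ≤ K :=
  (hW.abs_le x).trans (Set.indicator_le_self' (fun _ _ => hW.nonneg) x)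

lemma aestronglyMeasurable_ofReal : AEStronglyMeasurable (fun x => (W x : ℂ)) volume :=
  Complex.continuous_ofReal.comp_aestronglyMeasurable hW.aestronglyMeasurable

lemma memLp_mul (u : L2 d) : MemLp (fun x => (W x : ℂ) * u x) 2 volume := by
  refine (Lp.memLp u).of_le_mul (c := K) (hW.aestronglyMeasurable_ofReal.mul (Lp.memLp u).1)
    (Eventually.of_forall fun x => ?_)
  rw [norm_mul, Complex.norm_real, Real.norm_eq_abs]
  exact mul_le_mul_of_nonneg_right (hW.abs_le' x) (norm_nonneg _)

/-- Multiplication by a bounded potential. -/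
def mulOp : L2 d →L[ℂ] L2 d :=
  LinearMap.mkContinuous
    { toFun := fun u => (hW.memLp_mul u).toLp _
      map_add' := fun u v => by
        refine Lp.ext ?_
        filter_upwards [(hW.memLp_mul (u + v)).coeFn_toLp, (hW.memLp_mul u).coeFn_toLp,
          (hW.memLp_mul v).coeFn_toLp, Lp.coeFn_add u v,
          Lp.coeFn_add ((hW.memLp_mul u).toLp _) ((hW.memLp_mul v).toLp _)] with x h1 h2 h3 h4 h5
        rw [h1, h5, Pi.add_apply, h2, h3, h4, Pi.add_apply, mul_add]
      map_smul' := fun c u => by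
        refine Lp.ext ?_
        filter_upwards [(hW.memLp_mul (c • u)).coeFn_toLp, (hW.memLp_mul u).coeFn_toLp,
          Lp.coeFn_smul c u, Lp.coeFn_smul c ((hW.memLp_mul u).toLp _)] with x h1 h2 h3 h4
        rw [h1, RingHom.id_apply, h4, Pi.smul_apply, h2, h3, Pi.smul_apply]
        simp only [smul_eq_mul]; ring }
    K (fun u => by
      refine Lp.norm_le_mul_norm_of_ae_le_mul ?_
      filter_upwards [(hW.memLp_mul u).coeFn_toLp] with x h1
      simp only [LinearMap.coe_mk, AddHom.coe_mk]
      rw [h1, norm_mul, Complex.norm_real, Real.norm_eq_abs]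
      exact mul_le_mul_of_nonneg_right (hW.abs_le' x) (norm_nonneg _))

lemma coeFn_mulOp (u : L2 d) : hW.mulOp u =ᵐ[volume] fun x => (W x : ℂ) * u x :=
  (hW.memLp_mul u).coeFn_toLp

lemma inner_mulOp (φ u : L2 d) :
    inner ℂ φ (hW.mulOp u) = ∫ x, (W x : ℂ) * (conj (φ x) * u x) := by
  rw [L2.inner_def]
  refine integral_congr_ae ?_
  filter_upwards [hW.coeFn_mulOp u] with x hx
  rw [hx, RCLike.inner_apply]
  ring

lemma integrable (φ u : L2 d) :
    Integrable (fun x => (W x : ℂ) * (conj (φ x) * u x)) volume := by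
  refine (L2.integrable_inner φ (hW.mulOp u)).congr ?_
  filter_upwards [hW.coeFn_mulOp u] with x hx
  rw [hx, RCLike.inner_apply]
  ring

lemma form_eq (φ u : H1 d) : form W φ u =
    (∑ i : Fin d, inner ℂ (grad i φ) (grad i u)) + inner ℂ (φ : L2 d) (hW.mulOp u) := by
  rw [form, hW.inner_mulOp]

/-- The sesquilinear form of `-Δ + W - E`. -/
def shiftedForm (E : ℝ) : H1 d →ₗ⋆[ℂ] H1 d →ₗ[ℂ] ℂ :=
  LinearMap.mk₂'ₛₗ (starRingEnd ℂ) (RingHom.id ℂ)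
    (fun φ u => form W φ u - E * inner ℂ (φ : L2 d) (u : L2 d))
    (fun φ ψ u => by
      simp only [hW.form_eq, map_add, Submodule.coe_add, inner_add_left, Finset.sum_add_distrib]
      ring)
    (fun c φ u => by
      simp only [hW.form_eq, map_smul, Submodule.coe_smul, inner_smul_left, smul_eq_mul,
        ← Finset.mul_sum]
      ring)
    (fun φ u v => by
      simp only [hW.form_eq, map_add, Submodule.coe_add, inner_add_right, Finset.sum_add_distrib]
      ring)
    (fun c φ u => by
      simp only [hW.form_eq, map_smul, Submodule.coe_smul, inner_smul_right, smul_eq_mul,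
        ← Finset.mul_sum, RingHom.id_apply]
      ring)

lemma shiftedForm_apply (E : ℝ) (φ u : H1 d) :
    hW.shiftedForm E φ u = form W φ u - E * inner ℂ (φ : L2 d) (u : L2 d) := rfl

lemma shiftedForm_conj_symm (E : ℝ) (φ u : H1 d) :
    conj (hW.shiftedForm E φ u) = hW.shiftedForm E u φ := by
  rw [shiftedForm_apply, shiftedForm_apply, map_sub, form_conj_symm, map_mul, Complex.conj_ofReal,
    inner_conj_symm]

lemma re_form_self (u : H1 d) : (form W u u).re =
    (∑ i : Fin d, ‖grad i u‖ ^ 2) + (inner ℂ (u : L2 d) (hW.mulOp u)).re := by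
  rw [hW.form_eq, Complex.add_re, Complex.re_sum]
  congr 1
  exact Finset.sum_congr rfl fun i _ => inner_self_eq_norm_sq (𝕜 := ℂ) _

lemma re_shiftedForm_self (E : ℝ) (u : H1 d) :
    (hW.shiftedForm E u u).re = (form W u u).re - E * ‖(u : L2 d)‖ ^ 2 := by
  rw [shiftedForm_apply, Complex.sub_re, Complex.re_ofReal_mul]
  congr 2
  exact inner_self_eq_norm_sq (𝕜 := ℂ) _

/-- The potential sees only `B`, so its contribution is controlled by the norm in which Rellich's
theorem gives compactness. -/
lemma norm_inner_mulOp_le (u : L2 d) : ‖inner ℂ u (hW.mulOp u)‖ ≤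
    K * (eLpNorm u 2 (volume.restrict B)).toReal ^ 2 := by
  have hu : MemLp u 2 (volume.restrict B) := (Lp.memLp u).restrict B
  have h1 : K * (eLpNorm u 2 (volume.restrict B)).toReal ^ 2 = ∫ x in B, K * ‖u x‖ ^ 2 := by
    rw [integral_const_mul]
    congr 1
    rw [hu.eLpNorm_eq_integral_rpow_norm (by norm_num) (by norm_num),
      ENNReal.toReal_ofReal (by positivity)]
    simp only [ENNReal.toReal_ofNat, Real.rpow_ofNat]
    rw [← Real.rpow_natCast, ← Real.rpow_mul (by positivity)]
    norm_num
  rw [h1, hW.inner_mulOp, ← integral_indicator hW.measurableSet]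
  refine norm_integral_le_of_norm_le ?_ (Eventually.of_forall fun x => ?_)
  · rw [integrable_indicator_iff hW.measurableSet]
    exact (hu.integrable_norm_pow (by norm_num)).const_mul K
  · have h2 := hW.abs_le x
    simp only [norm_mul, Complex.norm_real, RCLike.norm_conj, Real.norm_eq_abs]
    by_cases hx : x ∈ B
    · rw [Set.indicator_of_mem hx] at h2 ⊢
      rw [← sq]
      gcongr
    · rw [Set.indicator_of_notMem hx] at h2 ⊢
      rw [le_antisymm h2 (abs_nonneg _), zero_mul]

lemma norm_inner_mulOp_le' (u : L2 d) : ‖inner ℂ u (hW.mulOp u)‖ ≤ K * ‖u‖ ^ 2 := by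
  refine (hW.norm_inner_mulOp_le u).trans ?_
  have := hW.nonneg
  gcongr
  rw [Lp.norm_def]
  exact ENNReal.toReal_mono (Lp.eLpNorm_ne_top u) (eLpNorm_mono_measure _ Measure.restrict_le_self)

/-- The form of `-Δ + W` attains its infimum over the unit sphere of the orthogonal complement of
finitely many vectors if this infimum is negative. -/
lemma exists_minimizer (Y : Submodule ℂ (H1 d))
    (hY : ∀ (u : ℕ → H1 d) (v : H1 d), (∀ n, u n ∈ Y) →
      Tendsto (fun n => (u n : L2 d)) atTop (𝓝 (v : L2 d)) → v ∈ Y)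
    (w : H1 d) (hwY : w ∈ Y) (hw1 : ‖(w : L2 d)‖ = 1) (hneg : (form W w w).re < 0) :
    ∃ E : ℝ, E ≤ (form W w w).re ∧ ∃ u ∈ Y, ‖(u : L2 d)‖ = 1 ∧ (form W u u).re = E ∧
      ∀ y ∈ Y, 0 ≤ (hW.shiftedForm E y y).re := by
  set S : Set ℝ := {r | ∃ u ∈ Y, ‖(u : L2 d)‖ = 1 ∧ (form W u u).re = r} with hS
  have hlow : ∀ u : H1 d, -(K * ‖(u : L2 d)‖ ^ 2) ≤ (form W u u).re - ∑ i, ‖grad i u‖ ^ 2 :=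
      fun u => by
    rw [hW.re_form_self]
    have h1 := (Complex.abs_re_le_norm _).trans (hW.norm_inner_mulOp_le' (u : L2 d))
    linarith [neg_le_of_abs_le h1]
  have hSne : S.Nonempty := ⟨_, w, hwY, hw1, rfl⟩
  have hSbdd : BddBelow S := by
    refine ⟨-K, ?_⟩
    rintro _ ⟨u, -, hu1, rfl⟩
    have h1 := hlow u
    rw [hu1] at h1
    have : 0 ≤ ∑ i, ‖grad i u‖ ^ 2 := Finset.sum_nonneg fun i _ => by positivity
    linarith
  set E := sInf S with hE
  have hEw : E ≤ (form W w w).re := csInf_le hSbdd ⟨w, hwY, hw1, rfl⟩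
  have hE0 : E < 0 := hEw.trans_lt hneg
  have hpos : ∀ y ∈ Y, 0 ≤ (hW.shiftedForm E y y).re := by
    intro y hy
    by_cases hy0 : (y : L2 d) = 0
    · have : y = 0 := Subtype.ext hy0
      simp [this]
    · have hn : ‖(y : L2 d)‖ ≠ 0 := by simpa using hy0
      set c : ℂ := ((‖(y : L2 d)‖⁻¹ : ℝ) : ℂ) with hc
      have h1 : ‖((c • y : H1 d) : L2 d)‖ = 1 := by
        rw [Submodule.coe_smul, norm_smul, hc, Complex.norm_real, norm_inv, norm_norm,
          inv_mul_cancel₀ hn]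
      have h2 : E ≤ (form W (c • y) (c • y)).re := csInf_le hSbdd ⟨_, Y.smul_mem c hy, h1, rfl⟩
      have h3 := hW.re_shiftedForm_self E (c • y)
      rw [h1] at h3
      have h4 : (hW.shiftedForm E (c • y) (c • y)).re =
          ‖(y : L2 d)‖⁻¹ ^ 2 * (hW.shiftedForm E y y).re := by
        rw [map_smul, LinearMap.map_smulₛₗ, LinearMap.smul_apply, hc, Complex.conj_ofReal,
          smul_eq_mul, smul_eq_mul, Complex.re_ofReal_mul, Complex.re_ofReal_mul]
        ring
      have h5 : 0 ≤ ‖(y : L2 d)‖⁻¹ ^ 2 * (hW.shiftedForm E y y).re := by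
        rw [← h4, h3]; linarith
      exact nonneg_of_mul_nonneg_right h5 (by positivity)
  obtain ⟨r, -, hr, hrS⟩ := exists_seq_tendsto_sInf hSne hSbdd
  choose u huY hu1 hur using hrS
  have hr' : Tendsto (fun n => (form W (u n) (u n)).re) atTop (𝓝 E) := by
    simpa only [hur] using hr
  obtain ⟨M, hM⟩ := hr'.bddAbove_range
  have hgrad : ∀ n i, ‖grad i (u n)‖ ≤ Real.sqrt (M + K) := fun n i => by
    refine Real.le_sqrt_of_sq_le ?_
    have h1 := hlow (u n)
    rw [hu1] at h1
    have h2 := hM (Set.mem_range_self n)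
    have h3 := Finset.single_le_sum (f := fun i => ‖grad i (u n)‖ ^ 2)
      (fun i _ => by positivity) (Finset.mem_univ i)
    linarith
  obtain ⟨σ, hσ, hlim⟩ := exists_subseq_tendsto_eLpNorm_restrict B hW.measure_ne_top u
    (max 1 (Real.sqrt (M + K))) (fun n => (hu1 n).le.trans (le_max_left _ _))
    (fun n i => (hgrad n i).trans (le_max_right _ _))
  have hrσ := hr'.comp hσ.tendsto_atTop
  -- Parallelogram law, with the nonnegative value at the sum discarded.
  have hform : ∀ m n, (hW.shiftedForm E (u m - u n) (u m - u n)).re ≤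
      2 * ((form W (u m) (u m)).re - E) + 2 * ((form W (u n) (u n)).re - E) := by
    intro m n
    have h1 := re_sesq_parallelogram (hW.shiftedForm E) (u m) (u n)
    have h2 := hpos _ (Y.add_mem (huY m) (huY n))
    have h3 := hW.re_shiftedForm_self E (u m)
    have h4 := hW.re_shiftedForm_self E (u n)
    rw [hu1] at h3 h4
    linarith
  -- Since E < 0, the mass term -E‖·‖² is positive and the left side controls the full H¹ norm.
  -- Compactness on `B` alone thus gives a Cauchy sequence on the whole space: no mass escapes to
  -- infinity.
  have hT : Tendsto (fun p : ℕ × ℕ => (∑ i, ‖grad i (u (σ p.1) - u (σ p.2))‖ ^ 2) +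
      -E * ‖((u (σ p.1) - u (σ p.2) : H1 d) : L2 d)‖ ^ 2) (atTop ×ˢ atTop) (𝓝 0) := by
    have h1 : Tendsto (fun p : ℕ × ℕ => 2 * ((form W (u (σ p.1)) (u (σ p.1))).re - E) +
        2 * ((form W (u (σ p.2)) (u (σ p.2))).re - E) +
        K * (eLpNorm ((u (σ p.1) - u (σ p.2) : H1 d) : L2 d) 2 (volume.restrict B)).toReal ^ 2)
        (atTop ×ˢ atTop) (𝓝 (2 * (E - E) + 2 * (E - E) + K * (0 : ℝ≥0∞).toReal ^ 2)) := by
      refine Tendsto.add (Tendsto.add ?_ ?_) ?_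
      · exact ((hrσ.comp tendsto_fst).sub_const E).const_mul 2
      · exact ((hrσ.comp tendsto_snd).sub_const E).const_mul 2
      · exact (((ENNReal.tendsto_toReal ENNReal.zero_ne_top).comp hlim).pow 2).const_mul K
    simp only [sub_self, mul_zero, add_zero, ENNReal.toReal_zero, ne_eq, OfNat.ofNat_ne_zero,
      not_false_eq_true, zero_pow] at h1
    refine squeeze_zero (fun p => ?_) (fun p => ?_) h1
    · have : 0 ≤ ∑ i, ‖grad i (u (σ p.1) - u (σ p.2))‖ ^ 2 :=
        Finset.sum_nonneg fun i _ => by positivity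
      have h2 : 0 ≤ -E * ‖((u (σ p.1) - u (σ p.2) : H1 d) : L2 d)‖ ^ 2 :=
        mul_nonneg (by linarith) (by positivity)
      linarith
    · have h2 := hform (σ p.1) (σ p.2)
      rw [hW.re_shiftedForm_self, hW.re_form_self] at h2
      have h3 := (Complex.abs_re_le_norm _).trans
        (hW.norm_inner_mulOp_le ((u (σ p.1) - u (σ p.2) : H1 d) : L2 d))
      linarith [neg_le_of_abs_le h3]
  have hcau : CauchySeq fun n => (u (σ n) : L2 d) := by
    rw [cauchySeq_iff_tendsto_dist_atTop_0, ← prod_atTop_atTop_eq]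
    have h1 : Tendsto (fun p : ℕ × ℕ => ‖((u (σ p.1) - u (σ p.2) : H1 d) : L2 d)‖ ^ 2)
        (atTop ×ˢ atTop) (𝓝 0) := by
      have h2 := hT.const_mul (-E)⁻¹
      rw [mul_zero] at h2
      refine squeeze_zero (fun p => by positivity) (fun p => ?_) h2
      rw [inv_mul_eq_div, le_div_iff₀ (by linarith), mul_comm]
      exact le_add_of_nonneg_left (Finset.sum_nonneg fun i _ => by positivity)
    have h2 := h1.sqrt
    rw [Real.sqrt_zero] at h2
    refine h2.congr fun p => ?_
    rw [Real.sqrt_sq (norm_nonneg _), dist_eq_norm, Submodule.coe_sub]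
  have hcaug : ∀ i, CauchySeq fun n => grad i (u (σ n)) := by
    intro i
    rw [cauchySeq_iff_tendsto_dist_atTop_0, ← prod_atTop_atTop_eq]
    have h1 : Tendsto (fun p : ℕ × ℕ => ‖grad i (u (σ p.1) - u (σ p.2))‖ ^ 2)
        (atTop ×ˢ atTop) (𝓝 0) := by
      refine squeeze_zero (fun p => by positivity) (fun p => ?_) hT
      refine (Finset.single_le_sum (f := fun i => ‖grad i (u (σ p.1) - u (σ p.2))‖ ^ 2)
        (fun i _ => by positivity) (Finset.mem_univ i)).trans (le_add_of_nonneg_right ?_)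
      exact mul_nonneg (by linarith) (by positivity)
    have h2 := h1.sqrt
    rw [Real.sqrt_zero] at h2
    refine h2.congr fun p => ?_
    rw [Real.sqrt_sq (norm_nonneg _), dist_eq_norm, map_sub]
  obtain ⟨v, hv⟩ := cauchySeq_tendsto_of_complete hcau
  choose g hg using fun i => cauchySeq_tendsto_of_complete (hcaug i)
  obtain ⟨z, rfl, hzg⟩ := exists_H1_of_tendsto hv hg
  refine ⟨E, hEw, z, hY _ z (fun n => huY (σ n)) hv, ?_, ?_, hpos⟩
  · refine tendsto_nhds_unique hv.norm ?_
    simp only [hu1, tendsto_const_nhds]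
  -- Convergence is strong in H¹, so the form passes to the limit with equality and no lower
  -- semicontinuity argument is needed.
  · refine tendsto_nhds_unique ?_ hrσ
    simp only [Function.comp_def, hW.re_form_self]
    refine Tendsto.add (tendsto_finsetSum _ fun i _ => ?_) ?_
    · rw [hzg]
      exact (hg i).norm.pow 2
    · exact (Complex.continuous_re.tendsto _).comp
        (hv.inner ((hW.mulOp.continuous.tendsto _).comp hv))

/-- Given weak eigenfunctions `v j` and a test function `w` orthogonal to them with negative energy,
there is a further eigenfunction whose eigenvalue is at most the energy of `w`. -/
lemma exists_eigenvector {ι : Type*} [Fintype ι] (v : ι → H1 d) (e : ι → ℝ)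
    (hv : Orthonormal ℂ fun j => (v j : L2 d))
    (hev : ∀ j (φ : H1 d), form W φ (v j) = e j * inner ℂ (φ : L2 d) (v j : L2 d))
    (w : H1 d) (hwv : ∀ j, inner ℂ (v j : L2 d) (w : L2 d) = 0) (hw1 : ‖(w : L2 d)‖ = 1)
    (hneg : (form W w w).re < 0) :
    ∃ E : ℝ, E ≤ (form W w w).re ∧ ∃ u : H1 d, ‖(u : L2 d)‖ = 1 ∧
      (∀ j, inner ℂ (v j : L2 d) (u : L2 d) = 0) ∧
      ∀ φ : H1 d, form W φ u = E * inner ℂ (φ : L2 d) (u : L2 d) := by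
  classical
  let Y : Submodule ℂ (H1 d) :=
    ⨅ j, LinearMap.ker ((innerₛₗ ℂ (v j : L2 d)) ∘ₗ (H1 d).subtype)
  have hmem : ∀ y, y ∈ Y ↔ ∀ j, inner ℂ (v j : L2 d) (y : L2 d) = 0 := fun y => by
    simp [Y, Submodule.mem_iInf]
  obtain ⟨E, hE, u, huY, hu1, huE, hpos⟩ := hW.exists_minimizer Y
    (fun u z hu hz => (hmem z).2 fun j => tendsto_nhds_unique (tendsto_const_nhds.inner hz) (by
      simp only [fun n => (hmem _).1 (hu n) j, tendsto_const_nhds])) w ((hmem w).2 hwv) hw1 hneg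
  have h0 : (hW.shiftedForm E u u).re = 0 := by
    rw [hW.re_shiftedForm_self, huE, hu1]; ring
  refine ⟨E, hE, u, hu1, (hmem u).1 huY, fun φ => ?_⟩
  have hY0 : ∀ y ∈ Y, hW.shiftedForm E y u = 0 := fun y hy =>
    sesq_eq_zero_of_nonneg _ (hW.shiftedForm_conj_symm E) Y hpos huY h0 hy
  -- Minimality gives stationarity only along `Y`. Along `v j` both terms vanish, since `v j` is a
  -- weak eigenfunction orthogonal to `u`.
  have hv0 : ∀ j, hW.shiftedForm E (v j) u = 0 := fun j => by
    rw [← hW.shiftedForm_conj_symm, hW.shiftedForm_apply, hev,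
      ← inner_conj_symm (u : L2 d), (hmem u).1 huY j]
    simp
  set ψ : H1 d := φ - ∑ j, (inner ℂ (v j : L2 d) (φ : L2 d)) • v j with hψ
  have hψY : ψ ∈ Y := (hmem ψ).2 fun j => by
    simp only [hψ, Submodule.coe_sub, Submodule.coe_sum, Submodule.coe_smul, inner_sub_right,
      inner_sum, inner_smul_right, orthonormal_iff_ite.1 hv]
    simp
  have h1 : hW.shiftedForm E φ u = 0 := by
    have h2 : φ = ψ + ∑ j, (inner ℂ (v j : L2 d) (φ : L2 d)) • v j := by simp [hψ]
    rw [h2, map_add, LinearMap.add_apply, hY0 ψ hψY, zero_add, map_sum, LinearMap.sum_apply]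
    refine Finset.sum_eq_zero fun j _ => ?_
    rw [map_smulₛₗ, LinearMap.smul_apply, hv0, smul_zero]
  rw [hW.shiftedForm_apply] at h1
  exact sub_eq_zero.1 h1

end IsBoundedOn

/-! ### From weak eigenfunctions to operator eigenspaces and back. -/

/-- The graph of the Schrödinger operator in `L² × L²`. -/
abbrev schrodingerGraph (V : Space d → ℝ) : Submodule ℂ (L2 d × L2 d) :=
  (schrodingerWeakGraph V).map
    ((H1 d).subtype.prodMap (LinearMap.id : L2 d →ₗ[ℂ] L2 d))

lemma mem_schrodingerGraph {V : Space d → ℝ} {p : L2 d × L2 d} :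
    p ∈ schrodingerGraph V ↔ ∃ u : H1 d, (u, p.2) ∈ schrodingerWeakGraph V ∧ (u : L2 d) = p.1 := by
  obtain ⟨a, b⟩ := p
  simp only [Submodule.mem_map, Prod.exists, LinearMap.prodMap_apply, Submodule.subtype_apply,
    LinearMap.id_apply, Prod.mk.injEq]
  constructor
  · rintro ⟨u, f, h, rfl, rfl⟩
    exact ⟨u, h, rfl⟩
  · rintro ⟨u, h, rfl⟩
    exact ⟨u, b, h, rfl, rfl⟩

lemma mem_eigenspace {T : L2 d →ₗ.[ℂ] L2 d} {μ : ℂ} {x : T.domain} :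
    x ∈ eigenspace T μ ↔ T x = μ • (x : L2 d) := by
  rw [eigenspace, LinearMap.mem_ker, LinearMap.sub_apply, sub_eq_zero]
  rfl

/-- For a general potential the weak graph need not be functional, in which case `toLinearPMap`
takes the default value 0 on its domain. An eigenvector with μ ≠ 0 is then zero, so nothing spurious
is counted. -/
lemma mem_schrodingerGraph_of_mem_eigenspace {V : Space d → ℝ} {μ : ℂ} (hμ : μ ≠ 0)
    {x : (schrodingerOperator V).domain} (hx : x ∈ eigenspace (schrodingerOperator V) μ) :
    ((x : L2 d), μ • (x : L2 d)) ∈ schrodingerGraph V := by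
  by_cases hg : ∀ p ∈ schrodingerGraph V, p.1 = 0 → p.2 = 0
  · have h := Submodule.mem_graph_toLinearPMap hg x
    have h2 := mem_eigenspace.1 hx
    rw [← h2]
    exact h
  · have h0 : (schrodingerOperator V).toFun = 0 := dif_neg hg
    have h1 : (schrodingerOperator V) x = 0 := by
      change (schrodingerOperator V).toFun x = 0
      rw [h0]; rfl
    have h2 := mem_eigenspace.1 hx
    rw [h1] at h2
    have h3 : (x : L2 d) = 0 := (smul_eq_zero.1 h2.symm).resolve_left hμ
    rw [h3, smul_zero]
    exact Submodule.zero_mem _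

namespace IsBoundedOn

variable {W : Space d → ℝ} {B : Set (Space d)} {K : ℝ} (hW : IsBoundedOn W B K)
include hW

lemma formDomain_eq : formDomain W = Set.univ :=
  Set.eq_univ_of_forall fun u => hW.integrable (u : L2 d) (u : L2 d)

lemma mem_schrodingerWeakGraph {u : H1 d} {f : L2 d} :
    (u, f) ∈ schrodingerWeakGraph W ↔ ∀ φ : H1 d, form W φ u = inner ℂ (φ : L2 d) f := by
  constructor
  · intro h φ
    exact (h.2 φ (by rw [hW.formDomain_eq]; trivial)).2
  · intro h
    exact ⟨by rw [hW.formDomain_eq]; trivial, fun φ _ => ⟨hW.integrable _ _, h φ⟩⟩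

/-- The second component is orthogonal to the form domain H¹, which is dense in L². -/
lemma schrodingerGraph_functional (p : L2 d × L2 d) (hp : p ∈ schrodingerGraph W)
    (h0 : p.1 = 0) : p.2 = 0 := by
  obtain ⟨u, hu, hup⟩ := mem_schrodingerGraph.1 hp
  have hu0 : u = 0 := Subtype.ext (hup.trans h0)
  rw [hW.mem_schrodingerWeakGraph] at hu
  refine (dense_H1 d).eq_zero_of_inner_right ℂ fun φ hφ => ?_
  rw [← hu ⟨φ, hφ⟩, hu0, hW.form_eq]
  simp

lemma exists_mem_eigenspace {E : ℝ} {u : H1 d}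
    (hu : ∀ φ : H1 d, form W φ u = E * inner ℂ (φ : L2 d) (u : L2 d)) :
    ∃ x : (schrodingerOperator W).domain, (x : L2 d) = u ∧
      x ∈ eigenspace (schrodingerOperator W) (E : ℂ) := by
  have h1 : ((u : L2 d), (E : ℂ) • (u : L2 d)) ∈ schrodingerGraph W :=
    mem_schrodingerGraph.2 ⟨u, hW.mem_schrodingerWeakGraph.2 fun φ => by
      rw [hu, inner_smul_right], rfl⟩
  have h2 : (schrodingerOperator W).graph = schrodingerGraph W :=
    Submodule.toLinearPMap_graph_eq _ hW.schrodingerGraph_functional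
  rw [← h2, LinearPMap.mem_graph_iff] at h1
  obtain ⟨y, hy1, hy2⟩ := h1
  exact ⟨y, hy1, mem_eigenspace.2 (by rw [hy2, hy1])⟩

lemma card_le_eigenvalueMultiplicity {ι : Type*} (s : Finset ι) (v : ι → H1 d)
    (hv : Orthonormal ℂ fun j => (v j : L2 d)) (E : ℝ)
    (hev : ∀ j ∈ s, ∀ φ : H1 d, form W φ (v j) = E * inner ℂ (φ : L2 d) (v j : L2 d)) :
    (s.card : ℕ∞) ≤ eigenvalueMultiplicity (schrodingerOperator W) E := by
  choose x hx hxe using fun j : s => hW.exists_mem_eigenspace (hev j j.2)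
  have hli : LinearIndependent ℂ fun j : s =>
      (⟨x j, hxe j⟩ : eigenspace (schrodingerOperator W) (E : ℂ)) := by
    have h1 : LinearIndependent ℂ fun j : s => (v j : L2 d) :=
      hv.linearIndependent.comp _ Subtype.val_injective
    refine LinearIndependent.of_comp
      ((schrodingerOperator W).domain.subtype ∘ₗ
        (eigenspace (schrodingerOperator W) (E : ℂ)).subtype) ?_
    convert h1 using 2 with j
    exact hx j
  have h2 := hli.cardinal_lift_le_rank
  rw [eigenvalueMultiplicity]
  have h3 := Cardinal.toENat.monotone' h2
  simpa using h3

/-- Sums over orthonormal families of eigenfunctions are bounded by the full eigenvalue sum. -/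
lemma sum_le_eigenvalueSum {ι : Type*} [Fintype ι] (v : ι → H1 d) (e : ι → ℝ)
    (hv : Orthonormal ℂ fun j => (v j : L2 d)) (he : ∀ j, e j < 0)
    (hev : ∀ j (φ : H1 d), form W φ (v j) = e j * inner ℂ (φ : L2 d) (v j : L2 d)) (γ : ℝ) :
    ∑ j, ENNReal.ofReal (|e j| ^ γ) ≤ eigenvalueSum γ W := by
  classical
  -- Values of `e` may repeat; grouping indices by value matches the sum with multiplicities.
  let e' : ι → Set.Iio (0 : ℝ) := fun j => ⟨e j, he j⟩
  have h1 : ∑ j, ENNReal.ofReal (|e j| ^ γ) = ∑ E ∈ Finset.univ.image e',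
      (Finset.univ.filter fun j => e' j = E).card • ENNReal.ofReal (|(E : ℝ)| ^ γ) :=
    Finset.sum_comp (fun E : Set.Iio (0 : ℝ) => ENNReal.ofReal (|(E : ℝ)| ^ γ)) e'
  rw [h1, eigenvalueSum]
  refine le_trans (Finset.sum_le_sum fun E _ => ?_) (ENNReal.sum_le_tsum (Finset.univ.image e'))
  rw [nsmul_eq_mul]
  gcongr
  have h2 := hW.card_le_eigenvalueMultiplicity (Finset.univ.filter fun j => e' j = E) v hv E
    (fun j hj φ => by
      have : e j = E := congrArg Subtype.val (Finset.mem_filter.1 hj).2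
      rw [hev, this])
  exact_mod_cast ENat.toENNReal_le.2 h2

/-! ### The variational principle. -/

/-- Induction on `N`, as in min-max: the N+1 coefficients of the `u j` face N linear conditions, so
some nonzero combination is orthogonal to the eigenfunctions already found. By monotonicity its
energy per unit mass is at most the last `μ`, and minimising on the orthogonal complement gives the
next eigenfunction. -/
lemma exists_eigenvectors_of_monotone {N : ℕ} (u : Fin N → H1 d) (μ : Fin N → ℝ)
    (hu : Orthonormal ℂ fun j => (u j : L2 d)) (hμ : Monotone μ) (hμ0 : ∀ j, μ j < 0)
    (hform : ∀ c : Fin N → ℂ, (form W (∑ j, c j • u j) (∑ j, c j • u j)).re ≤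
      ∑ j, μ j * ‖c j‖ ^ 2) :
    ∃ (v : Fin N → H1 d) (e : Fin N → ℝ), (Orthonormal ℂ fun j => (v j : L2 d)) ∧
      (∀ j, e j ≤ μ j) ∧
      ∀ j (φ : H1 d), form W φ (v j) = e j * inner ℂ (φ : L2 d) (v j : L2 d) := by
  induction N with
  | zero => exact ⟨u, μ, hu, fun _ => le_rfl, fun j => j.elim0⟩
  | succ N ih =>
    obtain ⟨v, e, hv, heμ, hev⟩ := ih (fun j => u j.castSucc) (fun j => μ j.castSucc)
      (hu.comp _ (Fin.castSucc_injective N)) (fun i j hij => hμ (Fin.castSucc_le_castSucc_iff.2 hij))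
      (fun j => hμ0 _) (fun c => by
        have h := hform (Fin.snoc c 0)
        simpa [Fin.sum_univ_castSucc] using h)
    let Λ : (Fin (N + 1) → ℂ) →ₗ[ℂ] (Fin N → ℂ) :=
      LinearMap.pi fun i => (innerₛₗ ℂ (v i : L2 d)) ∘ₗ (H1 d).subtype ∘ₗ
        Fintype.linearCombination ℂ u
    obtain ⟨c, hcΛ, hc0⟩ := (Submodule.ne_bot_iff _).1
      (LinearMap.ker_ne_bot_of_finrank_lt (f := Λ) (by simp))
    set w0 : H1 d := ∑ j, c j • u j with hw0
    have horth : ∀ i, inner ℂ (v i : L2 d) (w0 : L2 d) = 0 := fun i => by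
      have := congrFun (LinearMap.mem_ker.1 hcΛ) i
      simpa [Λ, Fintype.linearCombination_apply, hw0] using this
    have hnorm : ‖(w0 : L2 d)‖ ^ 2 = ∑ j, ‖c j‖ ^ 2 := by
      have h1 : (w0 : L2 d) = ∑ j, c j • (u j : L2 d) := by simp [hw0]
      have h2 : inner ℂ (w0 : L2 d) (w0 : L2 d) = ∑ j, conj (c j) * c j := by
        rw [h1, hu.inner_sum]
      have h3 := congrArg Complex.re h2
      rw [Complex.re_sum] at h3
      have h4 : (inner ℂ (w0 : L2 d) (w0 : L2 d)).re = ‖(w0 : L2 d)‖ ^ 2 :=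
        inner_self_eq_norm_sq (𝕜 := ℂ) _
      rw [← h4, h3]
      refine Finset.sum_congr rfl fun j _ => ?_
      rw [mul_comm, Complex.mul_conj, Complex.ofReal_re, Complex.normSq_eq_norm_sq]
    have hpos : 0 < ‖(w0 : L2 d)‖ := by
      obtain ⟨j, hj⟩ := Function.ne_iff.1 hc0
      have h1 : 0 < ∑ j, ‖c j‖ ^ 2 := Finset.sum_pos' (fun j _ => by positivity)
        ⟨j, Finset.mem_univ _, by have := norm_pos_iff.2 hj; positivity⟩
      rw [← hnorm] at h1
      exact (norm_nonneg _).lt_of_ne fun h => by simp [← h] at h1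
    have hle : (form W w0 w0).re ≤ μ (Fin.last N) * ‖(w0 : L2 d)‖ ^ 2 := by
      refine (hform c).trans ?_
      rw [hnorm, Finset.mul_sum]
      exact Finset.sum_le_sum fun j _ =>
        mul_le_mul_of_nonneg_right (hμ (Fin.le_last j)) (by positivity)
    set r : ℂ := ((‖(w0 : L2 d)‖⁻¹ : ℝ) : ℂ) with hr
    have hw1 : ‖((r • w0 : H1 d) : L2 d)‖ = 1 := by
      rw [Submodule.coe_smul, norm_smul, hr, Complex.norm_real, norm_inv, norm_norm,
        inv_mul_cancel₀ hpos.ne']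
    have hle' : (form W (r • w0) (r • w0)).re ≤ μ (Fin.last N) := by
      have h0 : ∀ y : H1 d, form W y y = hW.shiftedForm 0 y y := fun y => by
        rw [hW.shiftedForm_apply]; simp
      rw [h0, map_smul, LinearMap.map_smulₛₗ, LinearMap.smul_apply, hr, Complex.conj_ofReal,
        smul_eq_mul, smul_eq_mul, Complex.re_ofReal_mul, Complex.re_ofReal_mul, ← h0, ← mul_assoc,
        ← mul_inv, inv_mul_le_iff₀ (by positivity)]
      linarith
    obtain ⟨E, hE, z, hz1, hzv, hze⟩ := hW.exists_eigenvector v e hv hev (r • w0)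
      (fun j => by rw [Submodule.coe_smul, inner_smul_right, horth, mul_zero]) hw1
      (hle'.trans_lt (hμ0 _))
    refine ⟨Fin.snoc v z, Fin.snoc e E, ?_, fun j => ?_, fun j => ?_⟩
    · rw [orthonormal_iff_ite]
      intro i j
      have hvz : ∀ j, inner ℂ (z : L2 d) (v j : L2 d) = 0 := fun j => by
        rw [← inner_conj_symm, hzv, map_zero]
      have hne : ∀ j : Fin N, Fin.last N ≠ j.castSucc := fun j => (Fin.castSucc_lt_last j).ne'
      refine Fin.lastCases ?_ (fun i => ?_) i <;> refine Fin.lastCases ?_ (fun j => ?_) j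
      · simp [hz1]
      · simp [hvz, hne]
      · simp [hzv, (hne _).symm]
      · simp [orthonormal_iff_ite.1 hv]
    · refine Fin.lastCases ?_ (fun j => ?_) j
      · simpa using hE.trans hle'
      · simpa using heμ j
    · refine Fin.lastCases ?_ (fun j => ?_) j
      · simpa using hze
      · simpa using hev j

/-- The variational principle for sums of powers of eigenvalues. -/
lemma sum_rpow_le_eigenvalueSum {ι : Type*} [Fintype ι] (u : ι → H1 d) (μ : ι → ℝ)
    (hu : Orthonormal ℂ fun j => (u j : L2 d)) (hμ0 : ∀ j, μ j < 0)
    (hform : ∀ c : ι → ℂ, (form W (∑ j, c j • u j) (∑ j, c j • u j)).re ≤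
      ∑ j, μ j * ‖c j‖ ^ 2) {γ : ℝ} (hγ : 0 ≤ γ) :
    ∑ j, ENNReal.ofReal (|μ j| ^ γ) ≤ eigenvalueSum γ W := by
  let ε := Fintype.equivFin ι
  let μ' : Fin (Fintype.card ι) → ℝ := fun k => μ (ε.symm k)
  -- The induction requires increasing levels, hence the sorting; here `τ` is a reindexing, not a
  -- spectral shift.
  let τ : Fin (Fintype.card ι) ≃ ι := (Tuple.sort μ').trans ε.symm
  obtain ⟨v, e, hv, heμ, hev⟩ := hW.exists_eigenvectors_of_monotone (fun k => u (τ k))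
    (fun k => μ (τ k)) (hu.comp _ τ.injective) (Tuple.monotone_sort μ') (fun _ => hμ0 _)
    (fun c => by
      have h := hform (fun j => c (τ.symm j))
      rw [← τ.sum_comp, ← τ.sum_comp (fun j => μ j * _)] at h
      simpa using h)
  rw [← τ.sum_comp]
  refine le_trans (Finset.sum_le_sum fun k _ => ?_)
    (hW.sum_le_eigenvalueSum v e hv (fun k => (heμ k).trans_lt (hμ0 _)) hev γ)
  refine ENNReal.ofReal_le_ofReal (Real.rpow_le_rpow (abs_nonneg _) ?_ hγ)
  have h1 := hμ0 (τ k)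
  have h2 := heμ k
  rw [abs_of_neg h1, abs_of_neg (h2.trans_lt h1)]
  linarith

end IsBoundedOn

/-! ### Truncated potentials and the comparison at level -τ. -/

lemma integral_form_self (V : Space d → ℝ) (u : L2 d) :
    ∫ x, (V x : ℂ) * (conj (u x) * u x) = ((∫ x, V x * ‖u x‖ ^ 2 : ℝ) : ℂ) := by
  refine Eq.trans ?_ (integral_ofReal (𝕜 := ℂ) (f := fun x => V x * ‖u x‖ ^ 2))
  refine integral_congr_ae (Eventually.of_forall fun x => ?_)
  simp only [Complex.conj_mul']
  push_cast
  rfl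

lemma re_form_self (V : Space d → ℝ) (u : H1 d) :
    (form V u u).re = (∑ i : Fin d, ‖grad i u‖ ^ 2) + ∫ x, V x * ‖(u : L2 d) x‖ ^ 2 := by
  rw [form, integral_form_self, Complex.add_re, Complex.re_sum, Complex.ofReal_re]
  congr 1
  exact Finset.sum_congr rfl fun i _ => inner_self_eq_norm_sq (𝕜 := ℂ) _

lemma integrable_of_mem_formDomain {V : Space d → ℝ} {u : H1 d} (hu : u ∈ formDomain V) :
    Integrable fun x => V x * ‖(u : L2 d) x‖ ^ 2 := by
  have h : Integrable (fun x => (V x : ℂ) * (conj ((u : L2 d) x) * (u : L2 d) x)) := hu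
  refine h.re.congr (Eventually.of_forall fun x => ?_)
  simp only [Complex.conj_mul']
  rw [← Complex.ofReal_pow, ← Complex.ofReal_mul]
  rfl

lemma integrable_norm_sq (u : L2 d) : Integrable fun x => ‖u x‖ ^ 2 :=
  (Lp.memLp u).integrable_norm_pow (by norm_num)

lemma integral_norm_sq (u : L2 d) : ∫ x, ‖u x‖ ^ 2 = ‖u‖ ^ 2 := by
  have h := inner_self_eq_norm_sq (𝕜 := ℂ) u
  rw [← h, L2.inner_def, ← integral_re (L2.integrable_inner u u)]
  exact integral_congr_ae (Eventually.of_forall fun x => (inner_self_eq_norm_sq (𝕜 := ℂ) _).symm)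

/-- Cauchy–Schwarz separates the coefficients from one fixed density, making the truncation error
uniform over the span. -/
lemma norm_sq_sum_le {ι : Type*} [Fintype ι] (u : ι → H1 d) (c : ι → ℂ) :
    ∀ᵐ x, ‖((∑ j, c j • u j : H1 d) : L2 d) x‖ ^ 2 ≤
      (∑ j, ‖c j‖ ^ 2) * ∑ j, ‖(u j : L2 d) x‖ ^ 2 := by
  have h1 : ((∑ j, c j • u j : H1 d) : L2 d) =ᵐ[volume] fun x => ∑ j, c j * (u j : L2 d) x := by
    have h2 : ((∑ j, c j • u j : H1 d) : L2 d) = ∑ j, c j • (u j : L2 d) := by simp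
    rw [h2]
    have h3 : ∀ᵐ x, ∀ j, (c j • (u j : L2 d) : L2 d) x = c j * (u j : L2 d) x :=
      ae_all_iff.2 fun j => Lp.coeFn_smul (c j) (u j : L2 d)
    filter_upwards [Lp.coeFn_finsetSum Finset.univ (fun j => c j • (u j : L2 d)), h3] with x h4 h5
    rw [h4, Finset.sum_apply]
    exact Finset.sum_congr rfl fun j _ => h5 j
  filter_upwards [h1] with x hx
  rw [hx]
  calc ‖∑ j, c j * (u j : L2 d) x‖ ^ 2 ≤ (∑ j, ‖c j‖ * ‖(u j : L2 d) x‖) ^ 2 := by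
        gcongr
        refine (norm_sum_le _ _).trans (le_of_eq ?_)
        simp only [norm_mul]
    _ ≤ _ := Finset.sum_mul_sq_le_sq_mul_sq _ _ _

/-- The truncations of the potential `-(V + τ)₋` to bounded potentials on balls. -/
def truncation (V : Space d → ℝ) (τ : ℝ) (n : ℕ) (x : Space d) : ℝ :=
  (Metric.ball (0 : Space d) n).indicator (fun x => -min ((V x + τ)⁻) n) x

lemma truncation_nonpos (V : Space d → ℝ) (τ : ℝ) (n : ℕ) (x : Space d) :
    truncation V τ n x ≤ 0 := by
  refine Set.indicator_nonpos (fun x _ => ?_) x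
  have : 0 ≤ min ((V x + τ)⁻) (n : ℝ) := le_min (negPart_nonneg _) (Nat.cast_nonneg _)
  linarith

lemma neg_negPart_le_truncation (V : Space d → ℝ) (τ : ℝ) (n : ℕ) (x : Space d) :
    -(V x + τ)⁻ ≤ truncation V τ n x := by
  rw [truncation]
  by_cases hx : x ∈ Metric.ball (0 : Space d) n
  · rw [Set.indicator_of_mem hx]
    exact neg_le_neg (min_le_left _ _)
  · rw [Set.indicator_of_notMem hx]
    exact neg_nonpos.2 (negPart_nonneg _)

lemma tendsto_truncation (V : Space d → ℝ) (τ : ℝ) (x : Space d) :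
    Tendsto (fun n => truncation V τ n x) atTop (𝓝 (-(V x + τ)⁻)) := by
  refine tendsto_const_nhds.congr' ?_
  obtain ⟨N, hN⟩ := exists_nat_gt (max ‖x‖ ((V x + τ)⁻))
  filter_upwards [eventually_ge_atTop N] with n hn
  have hn' : (N : ℝ) ≤ n := Nat.cast_le.2 hn
  rw [truncation, Set.indicator_of_mem, min_eq_left]
  · linarith [le_max_right ‖x‖ ((V x + τ)⁻)]
  · rw [mem_ball_zero_iff]
    linarith [le_max_left ‖x‖ ((V x + τ)⁻)]

lemma isBoundedOn_truncation {V : Space d → ℝ} (hV : AEStronglyMeasurable V volume) (τ : ℝ)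
    (n : ℕ) : IsBoundedOn (truncation V τ n) (Metric.ball 0 n) n where
  aestronglyMeasurable := by
    have h : AEMeasurable (fun x => -min ((V x + τ)⁻) (n : ℝ)) volume := by
      have h1 : AEMeasurable (fun x => (V x + τ)⁻) volume := by
        simp only [negPart_def]
        exact ((hV.aemeasurable.add_const τ).neg).sup_const 0
      exact (h1.min aemeasurable_const).neg
    exact (h.indicator measurableSet_ball).aestronglyMeasurable
  measurableSet := measurableSet_ball
  measure_ne_top := measure_ball_lt_top.ne
  nonneg := Nat.cast_nonneg _
  abs_le x := by
    rw [truncation]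
    by_cases hx : x ∈ Metric.ball (0 : Space d) n
    · rw [Set.indicator_of_mem hx, Set.indicator_of_mem hx, abs_neg,
        abs_of_nonneg (le_min (negPart_nonneg _) (Nat.cast_nonneg _))]
      exact min_le_right _ _
    · rw [Set.indicator_of_notMem hx, Set.indicator_of_notMem hx, abs_zero]

lemma IsBoundedOn.memLp {W : Space d → ℝ} {B : Set (Space d)} {K : ℝ} (hW : IsBoundedOn W B K)
    (p : ℝ≥0∞) : MemLp W p volume := by
  refine (memLp_indicator_const p hW.measurableSet K (Or.inr hW.measure_ne_top)).mono
    hW.aestronglyMeasurable (Eventually.of_forall fun x => ?_)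
  rw [Real.norm_eq_abs]
  exact (hW.abs_le x).trans (le_abs_self _)

/-- The weak graph is a subspace, so the combination may be tested against itself; orthonormality
then diagonalises the form. -/
lemma form_eq_of_mem_weakGraph {ι : Type*} [Fintype ι] {V : Space d → ℝ} (u : ι → H1 d) (E : ι → ℝ)
    (hu : Orthonormal ℂ fun j => (u j : L2 d))
    (huE : ∀ j, (u j, (E j : ℂ) • (u j : L2 d)) ∈ schrodingerWeakGraph V) (c : ι → ℂ) :
    (∑ j, c j • u j) ∈ formDomain V ∧
      (form V (∑ j, c j • u j) (∑ j, c j • u j)).re = ∑ j, E j * ‖c j‖ ^ 2 := by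
  have h := (schrodingerWeakGraph V).sum_mem
    fun j (_ : j ∈ Finset.univ) => (schrodingerWeakGraph V).smul_mem (c j) (huE j)
  simp only [Prod.smul_mk] at h
  have h' : (∑ j, c j • u j, ∑ j, (c j * E j) • (u j : L2 d)) ∈ schrodingerWeakGraph V := by
    convert h using 1
    ext1
    · simp [Prod.fst_sum]
    · simp [Prod.snd_sum, mul_smul]
  refine ⟨h'.1, ?_⟩
  rw [(h'.2 _ h'.1).2]
  have h1 : ((∑ j, c j • u j : H1 d) : L2 d) = ∑ j, c j • (u j : L2 d) := by simp
  rw [h1, hu.inner_sum, Complex.re_sum]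
  refine Finset.sum_congr rfl fun j _ => ?_
  rw [← mul_assoc, Complex.conj_mul', mul_comm, ← Complex.ofReal_pow, ← Complex.ofReal_mul,
    Complex.ofReal_re]

/-- Eigenvalues of `-Δ + V` below `-τ` are compared with those of `-Δ - (V + τ)₋`. -/
lemma sum_shifted_rpow_le {ι : Type*} [Fintype ι] {V : Space d → ℝ}
    (hV : AEStronglyMeasurable V volume) (u : ι → H1 d) (E : ι → ℝ)
    (hu : Orthonormal ℂ fun j => (u j : L2 d))
    (huE : ∀ j, (u j, (E j : ℂ) • (u j : L2 d)) ∈ schrodingerWeakGraph V)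
    {τ : ℝ} (hτ : 0 < τ) (hE : ∀ j, E j < -τ) {γ : ℝ} (hγ : 0 ≤ γ) {p : ℝ} (hp : 0 ≤ p)
    {q L : ℝ≥0∞} (hL : ∀ W : Space d → ℝ, MemLp W q volume →
      eigenvalueSum γ W ≤ L * ∫⁻ x, ENNReal.ofReal ((W x)⁻ ^ p)) :
    ∑ j, ENNReal.ofReal ((|E j| - τ) ^ γ) ≤ L * ∫⁻ x, ENNReal.ofReal ((V x + τ)⁻ ^ p) := by
  classical
  have hbd := fun n => isBoundedOn_truncation hV τ n
  have hVu : ∀ j, Integrable fun x => V x * ‖(u j : L2 d) x‖ ^ 2 := fun j =>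
    integrable_of_mem_formDomain (huE j).1
  set G : Space d → ℝ := fun x => ∑ j, ‖(u j : L2 d) x‖ ^ 2 with hG
  have hG0 : ∀ x, 0 ≤ G x := fun x => Finset.sum_nonneg fun j _ => by positivity
  have hGm : AEStronglyMeasurable G volume := by
    exact (integrable_finsetSum Finset.univ fun j _ => integrable_norm_sq (u j : L2 d)).1
  have hVG : Integrable fun x => |V x| * G x := by
    have h1 : Integrable fun x => V x * G x := by
      simp only [hG, Finset.mul_sum]
      exact integrable_finsetSum _ fun j _ => hVu j
    refine h1.norm.congr (Eventually.of_forall fun x => ?_)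
    simp only [norm_mul, Real.norm_eq_abs, abs_of_nonneg (hG0 x)]
  -- The truncation error: it lies between 0 and (V+τ)_- ≤ |V| (as τ > 0), and |V| G is integrable
  -- because the `u j` are in the form domain.
  set D : ℕ → Space d → ℝ := fun n x => truncation V τ n x + (V x + τ)⁻ with hD
  have hD0 : ∀ n x, 0 ≤ D n x := fun n x => by
    linarith [neg_negPart_le_truncation V τ n x]
  have hDV : ∀ n x, D n x ≤ |V x| := fun n x => by
    have h1 : (V x + τ)⁻ ≤ |V x| := by
      rw [negPart_def]
      refine sup_le ?_ (abs_nonneg _)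
      linarith [neg_le_abs (V x)]
    linarith [truncation_nonpos V τ n x]
  have hDm : ∀ n, AEStronglyMeasurable (fun x => D n x * G x) volume := fun n => by
    refine AEStronglyMeasurable.mul ((hbd n).aestronglyMeasurable.add ?_) hGm
    have h1 : AEMeasurable (fun x => (V x + τ)⁻) volume := by
      simp only [negPart_def]
      exact ((hV.aemeasurable.add_const τ).neg).sup_const 0
    exact h1.aestronglyMeasurable
  have hDle : ∀ n x, ‖D n x * G x‖ ≤ |V x| * G x := fun n x => by
    rw [Real.norm_of_nonneg (mul_nonneg (hD0 n x) (hG0 x))]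
    exact mul_le_mul_of_nonneg_right (hDV n x) (hG0 x)
  have hDint : ∀ n, Integrable fun x => D n x * G x := fun n =>
    hVG.mono' (hDm n) (Eventually.of_forall (hDle n))
  have hδ : Tendsto (fun n => ∫ x, D n x * G x) atTop (𝓝 0) := by
    have h1 := tendsto_integral_of_dominated_convergence (fun x => |V x| * G x) hDm hVG
      (fun n => Eventually.of_forall (hDle n)) (f := fun _ => (0 : ℝ))
      (Eventually.of_forall fun x => by
        have h2 := ((tendsto_truncation V τ x).add_const ((V x + τ)⁻)).mul_const (G x)
        simpa using h2)
    simpa using h1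
  -- From truncation ≤ V + τ + D: every level moves up by τ plus one common error, independent of
  -- `c`.
  have hform : ∀ n (c : ι → ℂ), (form (truncation V τ n) (∑ j, c j • u j) (∑ j, c j • u j)).re ≤
      ∑ j, (E j + τ + ∫ x, D n x * G x) * ‖c j‖ ^ 2 := by
    intro n c
    obtain ⟨hdom, hre⟩ := form_eq_of_mem_weakGraph u E hu huE c
    set w : H1 d := ∑ j, c j • u j with hw
    have hnorm : ‖(w : L2 d)‖ ^ 2 = ∑ j, ‖c j‖ ^ 2 := by
      have h1 : (w : L2 d) = ∑ j, c j • (u j : L2 d) := by simp [hw]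
      have h4 : (inner ℂ (w : L2 d) (w : L2 d)).re = ‖(w : L2 d)‖ ^ 2 :=
        inner_self_eq_norm_sq (𝕜 := ℂ) _
      rw [← h4, h1, hu.inner_sum, Complex.re_sum]
      refine Finset.sum_congr rfl fun j _ => ?_
      rw [mul_comm, Complex.mul_conj, Complex.ofReal_re, Complex.normSq_eq_norm_sq]
    have hVw := integrable_of_mem_formDomain hdom
    have hWw : Integrable fun x => truncation V τ n x * ‖(w : L2 d) x‖ ^ 2 :=
      integrable_of_mem_formDomain (by rw [(hbd n).formDomain_eq]; trivial)
    have hτw : Integrable fun x => τ * ‖(w : L2 d) x‖ ^ 2 := (integrable_norm_sq _).const_mul τ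
    have hDc := (hDint n).const_mul (∑ j, ‖c j‖ ^ 2)
    have hint : ∫ x, truncation V τ n x * ‖(w : L2 d) x‖ ^ 2 ≤
        ∫ x, ((V x * ‖(w : L2 d) x‖ ^ 2 + τ * ‖(w : L2 d) x‖ ^ 2) +
          (∑ j, ‖c j‖ ^ 2) * (D n x * G x)) := by
      refine integral_mono_ae hWw ((hVw.add hτw).add hDc) ?_
      filter_upwards [norm_sq_sum_le u c] with x hx
      have h1 : truncation V τ n x ≤ V x + τ + D n x := by
        have := neg_le_negPart (V x + τ)
        simp only [hD]
        linarith
      have h2 := mul_le_mul_of_nonneg_left hx (hD0 n x)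
      have h3 := mul_le_mul_of_nonneg_right h1 (sq_nonneg ‖(w : L2 d) x‖)
      calc truncation V τ n x * ‖(w : L2 d) x‖ ^ 2 ≤ _ := h3
        _ = V x * ‖(w : L2 d) x‖ ^ 2 + τ * ‖(w : L2 d) x‖ ^ 2 + D n x * ‖(w : L2 d) x‖ ^ 2 := by ring
        _ ≤ V x * ‖(w : L2 d) x‖ ^ 2 + τ * ‖(w : L2 d) x‖ ^ 2 +
            D n x * ((∑ j, ‖c j‖ ^ 2) * G x) := by gcongr
        _ = _ := by ring
    have hVτ : Integrable fun x => V x * ‖(w : L2 d) x‖ ^ 2 + τ * ‖(w : L2 d) x‖ ^ 2 :=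
      hVw.add hτw
    rw [integral_add hVτ hDc, integral_add hVw hτw, integral_const_mul,
      integral_const_mul, integral_norm_sq, hnorm] at hint
    rw [re_form_self] at hre ⊢
    simp only [add_mul, Finset.sum_add_distrib, ← Finset.mul_sum]
    linarith
  have hbound : ∀ ε : ℝ, 0 < ε → (∀ j, E j + τ + ε < 0) →
      ∑ j, ENNReal.ofReal (|E j + τ + ε| ^ γ) ≤ L * ∫⁻ x, ENNReal.ofReal ((V x + τ)⁻ ^ p) := by
    intro ε hε hneg
    -- The error is absorbed into the slack ε, which still leaves all the levels negative.
    obtain ⟨n, hn⟩ := (hδ.eventually (gt_mem_nhds hε)).exists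
    refine ((hbd n).sum_rpow_le_eigenvalueSum u (fun j => E j + τ + ε) hu hneg
      (fun c => (hform n c).trans ?_) hγ).trans ((hL _ ((hbd n).memLp q)).trans ?_)
    · refine Finset.sum_le_sum fun j _ => mul_le_mul_of_nonneg_right ?_ (by positivity)
      linarith
    · gcongr with x
      · rw [negPart_of_nonpos (truncation_nonpos V τ n x)]
        linarith [neg_negPart_le_truncation V τ n x]
  -- Letting ε → 0 recovers the exact shift by τ; the right side does not depend on ε or `n`.
  have hlim : Tendsto (fun ε : ℝ => ∑ j, ENNReal.ofReal (|E j + τ + ε| ^ γ)) (𝓝[>] 0)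
      (𝓝 (∑ j, ENNReal.ofReal ((|E j| - τ) ^ γ))) := by
    refine tendsto_finsetSum _ fun j _ => ENNReal.tendsto_ofReal ?_
    have h1 : |E j| - τ = |E j + τ + 0| := by
      have := hE j
      rw [abs_of_neg (by linarith), abs_of_neg (by linarith)]
      ring
    rw [h1]
    refine Tendsto.mono_left ?_ nhdsWithin_le_nhds
    refine Tendsto.rpow_const ?_ (Or.inr hγ)
    exact Continuous.tendsto (by fun_prop : Continuous fun ε : ℝ => |E j + τ + ε|) 0
  refine le_of_tendsto hlim ?_
  have hev : ∀ᶠ ε : ℝ in 𝓝[>] 0, ∀ j, E j + τ + ε < 0 := by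
    refine eventually_all.2 fun j => ?_
    have h2 : ∀ᶠ ε : ℝ in 𝓝 0, ε < -(E j + τ) := gt_mem_nhds (by linarith [hE j])
    filter_upwards [h2.filter_mono nhdsWithin_le_nhds] with ε h3
    linarith
  filter_upwards [hev, self_mem_nhdsWithin] with ε h1 h2
  exact hbound ε h2 h1

/-! ### Reduction to finite orthonormal families. -/

/-- The condition on (x, Ex) is linear in x, so it passes from independent eigenvectors to an
orthonormal basis of their span. -/
lemma exists_orthonormal_eigenvectors (V : Space d → ℝ) {E : ℝ} (hE : E < 0) {n : ℕ}
    (hn : (n : ℕ∞) ≤ eigenvalueMultiplicity (schrodingerOperator V) E) :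
    ∃ x : Fin n → L2 d, Orthonormal ℂ x ∧ ∀ k, (x k, (E : ℂ) • x k) ∈ schrodingerGraph V := by
  obtain ⟨f, hf⟩ := exists_linearIndependent_of_le_rank (Cardinal.natCast_le_toENat.1 hn)
  have hinj : Function.Injective ((schrodingerOperator V).domain.subtype ∘ₗ
      (eigenspace (schrodingerOperator V) (E : ℂ)).subtype) :=
    Subtype.val_injective.comp Subtype.val_injective
  have hg := hf.map' _ (LinearMap.ker_eq_bot.2 hinj)
  set g : Fin n → L2 d := ((schrodingerOperator V).domain.subtype ∘ₗ
    (eigenspace (schrodingerOperator V) (E : ℂ)).subtype) ∘ f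
  have hspan : Submodule.span ℂ (Set.range g) ≤
      (schrodingerGraph V).comap (LinearMap.id.prod ((E : ℂ) • LinearMap.id)) := by
    refine Submodule.span_le.2 ?_
    rintro _ ⟨k, rfl⟩
    exact mem_schrodingerGraph_of_mem_eigenspace (by exact_mod_cast hE.ne) (f k).2
  have := FiniteDimensional.span_of_finite ℂ (Set.finite_range g)
  let b := stdOrthonormalBasis ℂ (Submodule.span ℂ (Set.range g))
  have hcard : n = Module.finrank ℂ (Submodule.span ℂ (Set.range g)) := by
    rw [finrank_span_eq_card hg, Fintype.card_fin]
  refine ⟨fun k => (b (Fin.cast hcard k) : L2 d), ?_, fun k => hspan (b (Fin.cast hcard k)).2⟩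
  exact (b.orthonormal.comp_linearIsometry (Submodule.subtypeₗᵢ _)).comp _ (Fin.cast_injective hcard)

/-- Each eigenfunction is a legitimate test function for the other; Hermitian symmetry of the form
and real eigenvalues suffice. -/
lemma inner_eq_zero_of_ne {V : Space d → ℝ} {E E' : ℝ} (hne : E ≠ E') {u v : H1 d}
    (hu : (u, (E : ℂ) • (u : L2 d)) ∈ schrodingerWeakGraph V)
    (hv : (v, (E' : ℂ) • (v : L2 d)) ∈ schrodingerWeakGraph V) :
    inner ℂ (u : L2 d) (v : L2 d) = 0 := by
  have h1 := (hv.2 u hu.1).2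
  have h2 := congrArg conj (hu.2 v hv.1).2
  simp only [form_conj_symm, inner_smul_right, map_mul, Complex.conj_ofReal, inner_conj_symm]
    at h1 h2
  rw [h2] at h1
  have h3 : ((E : ℂ) - E') * inner ℂ (u : L2 d) (v : L2 d) = 0 := by rw [sub_mul, h1, sub_self]
  exact (mul_eq_zero.1 h3).resolve_left (sub_ne_zero.2 (by exact_mod_cast hne))

lemma tendsto_min_toENNReal (m : ℕ∞) :
    Tendsto (fun k : ℕ => (((min (k : ℕ∞) m).toNat : ℕ) : ℝ≥0∞)) atTop (𝓝 (m : ℝ≥0∞)) := by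
  induction m using ENat.recTopCoe with
  | top => simpa using ENNReal.tendsto_nat_nhds_top
  | coe n =>
    refine tendsto_const_nhds.congr' ?_
    filter_upwards [eventually_ge_atTop n] with k hk
    rw [min_eq_right (by exact_mod_cast hk)]
    simp

/-- To bound the eigenvalue sum it suffices to bound the sums over finite orthonormal families of
weak eigenfunctions. -/
lemma eigenvalueSum_le {V : Space d → ℝ} {γ : ℝ} {C : ℝ≥0∞}
    (h : ∀ (ι : Type) [Fintype ι] (u : ι → H1 d) (E : ι → ℝ),
      (Orthonormal ℂ fun j => (u j : L2 d)) → (∀ j, E j < 0) →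
      (∀ j, (u j, (E j : ℂ) • (u j : L2 d)) ∈ schrodingerWeakGraph V) →
      ∑ j, ENNReal.ofReal (|E j| ^ γ) ≤ C) : eigenvalueSum γ V ≤ C := by
  rw [eigenvalueSum, ENNReal.tsum_eq_iSup_sum]
  refine iSup_le fun F => ?_
  -- Multiplicities may be infinite, so they are capped at `k` to obtain finite families before k →
  -- ∞.
  let n : ℕ → Set.Iio (0 : ℝ) → ℕ := fun k E =>
    (min (k : ℕ∞) (eigenvalueMultiplicity (schrodingerOperator V) (E : ℝ))).toNat
  have hlim : Tendsto (fun k => ∑ E ∈ F, (n k E : ℝ≥0∞) * ENNReal.ofReal (|(E : ℝ)| ^ γ)) atTop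
      (𝓝 (∑ E ∈ F, (eigenvalueMultiplicity (schrodingerOperator V) (E : ℝ) : ℝ≥0∞) *
        ENNReal.ofReal (|(E : ℝ)| ^ γ))) :=
    tendsto_finsetSum _ fun E _ =>
      ENNReal.Tendsto.mul_const (tendsto_min_toENNReal _) (Or.inr ENNReal.ofReal_ne_top)
  refine le_of_tendsto' hlim fun k => ?_
  have hn : ∀ E : F, ((n k E : ℕ) : ℕ∞) ≤
      eigenvalueMultiplicity (schrodingerOperator V) ((E : Set.Iio (0 : ℝ)) : ℝ) := fun E =>
    (ENat.natCast_toNat_le_self _).trans (min_le_right _ _)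
  choose x hx hxg using fun E : F => exists_orthonormal_eigenvectors V E.1.2 (hn E)
  choose u hu hux using fun (E : F) k => mem_schrodingerGraph.1 (hxg E k)
  have hmem : ∀ (E : F) k, (u E k, ((E.1.1 : ℝ) : ℂ) • (u E k : L2 d)) ∈ schrodingerWeakGraph V :=
    fun E k => by
      have h1 := hu E k
      simp only at h1
      rwa [← show (u E k : L2 d) = x E k from hux E k] at h1
  have hsum := h (Σ E : F, Fin (n k E)) (fun j => u j.1 j.2) (fun j => (j.1.1 : ℝ)) ?_
    (fun j => j.1.1.2) (fun j => hmem j.1 j.2)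
  · rw [Fintype.sum_sigma] at hsum
    simp only [Finset.sum_const, Finset.card_univ, Fintype.card_fin, nsmul_eq_mul] at hsum
    rwa [Finset.sum_coe_sort F fun E => (n k E : ℝ≥0∞) * ENNReal.ofReal (|(E : ℝ)| ^ γ)] at hsum
  · classical
    rw [orthonormal_iff_ite]
    rintro ⟨E, i⟩ ⟨E', j⟩
    by_cases hE : E = E'
    · subst hE
      have h1 := orthonormal_iff_ite.1 (hx E) i j
      rw [← show (u E i : L2 d) = x E i from hux E i, ← show (u E j : L2 d) = x E j from hux E j]
        at h1
      simp [h1]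
    · rw [if_neg (fun h => hE (congrArg Sigma.fst h))]
      exact inner_eq_zero_of_ne (fun h => hE (Subtype.ext (Subtype.ext h))) (hmem E i) (hmem E' j)

/-! ### Beta integrals and integration over τ. -/

/-- This is the normalisation of the Beta density, cleared of its constant. -/
lemma lintegral_Ioo_zero_one_rpow_mul_rpow {s t : ℝ} (hs : 0 < s) (ht : 0 < t) :
    ∫⁻ x in Set.Ioo (0 : ℝ) 1, ENNReal.ofReal (x ^ (s - 1) * (1 - x) ^ (t - 1)) =
      ENNReal.ofReal (ProbabilityTheory.beta s t) := by
  have hβ := ProbabilityTheory.beta_pos hs ht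
  have h := ProbabilityTheory.lintegral_betaPDF_eq_one hs ht
  rw [ProbabilityTheory.lintegral_betaPDF] at h
  have h2 : ∫⁻ x in Set.Ioo (0 : ℝ) 1, ENNReal.ofReal (x ^ (s - 1) * (1 - x) ^ (t - 1)) =
      ENNReal.ofReal (ProbabilityTheory.beta s t) * ∫⁻ x in Set.Ioo (0 : ℝ) 1,
        ENNReal.ofReal (1 / ProbabilityTheory.beta s t * x ^ (s - 1) * (1 - x) ^ (t - 1)) := by
    rw [← lintegral_const_mul' _ _ ENNReal.ofReal_ne_top]
    refine lintegral_congr fun x => ?_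
    rw [← ENNReal.ofReal_mul hβ.le]
    congr 1
    field_simp
  rw [h2, h, mul_one]

lemma lintegral_Ioo_rpow_mul_rpow {s q a : ℝ} (hs : 0 < s) (hq : 0 ≤ q) (ha : 0 < a) :
    ∫⁻ x in Set.Ioo (0 : ℝ) a, ENNReal.ofReal (x ^ (s - 1) * (a - x) ^ q) =
      ENNReal.ofReal (a ^ (s + q) * ProbabilityTheory.beta s (q + 1)) := by
  have himg : (fun x => a * x) '' Set.Ioo (0 : ℝ) 1 = Set.Ioo 0 a := by
    rw [Set.image_mul_left_Ioo ha]; simp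
  rw [← himg, lintegral_image_eq_lintegral_abs_deriv_mul measurableSet_Ioo
    (f' := fun _ => a) (fun x _ => by simpa using ((hasDerivAt_id x).const_mul a).hasDerivWithinAt)
    (mul_right_injective₀ ha.ne').injOn, ENNReal.ofReal_mul (by positivity),
    ← lintegral_Ioo_zero_one_rpow_mul_rpow hs (by linarith : 0 < q + 1),
    ← lintegral_const_mul' _ _ ENNReal.ofReal_ne_top]
  refine setLIntegral_congr_fun measurableSet_Ioo fun x hx => ?_
  have h1 : 0 < 1 - x := by linarith [hx.2]
  rw [← ENNReal.ofReal_mul (abs_nonneg a), ← ENNReal.ofReal_mul (by positivity)]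
  congr 1
  rw [abs_of_pos ha, Real.mul_rpow ha.le hx.1.le, show a - a * x = a * (1 - x) by ring,
    Real.mul_rpow ha.le h1.le, show s + q = 1 + (s - 1) + q by ring, Real.rpow_add ha,
    Real.rpow_add ha, Real.rpow_one, add_sub_cancel_right]
  ring

lemma lintegral_rpow_mul_indicator {s q a : ℝ} (hs : 0 < s) (hq : 0 ≤ q) (ha : 0 ≤ a) :
    ∫⁻ τ in Set.Ioi (0 : ℝ), ENNReal.ofReal (τ ^ (s - 1)) *
      (Set.Iio a).indicator (fun τ => ENNReal.ofReal ((a - τ) ^ q)) τ =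
      ENNReal.ofReal (a ^ (s + q) * ProbabilityTheory.beta s (q + 1)) := by
  have h1 : ∀ τ : ℝ, ENNReal.ofReal (τ ^ (s - 1)) *
      (Set.Iio a).indicator (fun τ => ENNReal.ofReal ((a - τ) ^ q)) τ =
      (Set.Iio a).indicator
        (fun τ => ENNReal.ofReal (τ ^ (s - 1)) * ENNReal.ofReal ((a - τ) ^ q)) τ := fun τ => by
    by_cases hτ : τ ∈ Set.Iio a <;> simp [hτ]
  simp only [h1]
  rw [lintegral_indicator measurableSet_Iio, Measure.restrict_restrict measurableSet_Iio,
    Set.inter_comm, Set.Ioi_inter_Iio]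
  rcases ha.eq_or_lt with rfl | ha
  · rw [Real.zero_rpow (by linarith)]; simp
  · rw [← lintegral_Ioo_rpow_mul_rpow hs hq ha]
    exact setLIntegral_congr_fun measurableSet_Ioo fun τ hτ =>
      (ENNReal.ofReal_mul (Real.rpow_nonneg hτ.1.le _)).symm

lemma ofReal_negPart_add_rpow {p : ℝ} (hp : 0 < p) (v : ℝ) {τ : ℝ} (hτ : 0 < τ) :
    ENNReal.ofReal ((v + τ)⁻ ^ p) =
      (Set.Iio v⁻).indicator (fun τ => ENNReal.ofReal ((v⁻ - τ) ^ p)) τ := by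
  by_cases h : τ < v⁻
  · have hv : v < 0 := by
      by_contra hv
      rw [negPart_of_nonneg (not_lt.1 hv)] at h
      exact absurd h hτ.le.not_gt
    rw [Set.indicator_of_mem (Set.mem_Iio.2 h)]
    rw [negPart_of_nonpos hv.le] at h ⊢
    rw [negPart_of_nonpos (by linarith)]
    rw [neg_add']
  · rw [Set.indicator_of_notMem (fun h' => h (Set.mem_Iio.1 h')), negPart_of_nonneg, Real.zero_rpow hp.ne', ENNReal.ofReal_zero]
    linarith [neg_le_negPart v]

/-- Tonelli, then the Beta identity at each `x` with a = V_-(x). -/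
lemma lintegral_lintegral_negPart_add {V : Space d → ℝ} (hV : AEStronglyMeasurable V volume)
    {s p : ℝ} (hs : 0 < s) (hp : 0 < p) (L : ℝ≥0∞) :
    ∫⁻ τ in Set.Ioi (0 : ℝ), ENNReal.ofReal (τ ^ (s - 1)) *
      (L * ∫⁻ x, ENNReal.ofReal ((V x + τ)⁻ ^ p)) =
    L * (ENNReal.ofReal (ProbabilityTheory.beta s (p + 1)) *
      ∫⁻ x, ENNReal.ofReal ((V x)⁻ ^ (s + p))) := by
  have hpair : AEMeasurable (fun z : ℝ × Space d => ENNReal.ofReal (z.1 ^ (s - 1)) *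
      ENNReal.ofReal ((V z.2 + z.1)⁻ ^ p)) ((volume.restrict (Set.Ioi (0 : ℝ))).prod volume) := by
    have h1 : AEMeasurable (fun z : ℝ × Space d => V z.2)
        ((volume.restrict (Set.Ioi (0 : ℝ))).prod volume) := hV.comp_snd.aemeasurable
    simp only [negPart_def]
    have h2 : AEMeasurable (fun z : ℝ × Space d => ENNReal.ofReal (z.1 ^ (s - 1)))
        ((volume.restrict (Set.Ioi (0 : ℝ))).prod volume) :=
      (measurable_fst.pow_const _).ennreal_ofReal.aemeasurable
    have h3 : AEMeasurable (fun z : ℝ × Space d => -(V z.2 + z.1) ⊔ 0)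
        ((volume.restrict (Set.Ioi (0 : ℝ))).prod volume) :=
      (h1.add measurable_fst.aemeasurable).neg.sup_const 0
    exact h2.mul (h3.pow_const p).ennreal_ofReal
  have hswap := lintegral_lintegral_swap (f := fun (τ : ℝ) (x : Space d) =>
    ENNReal.ofReal (τ ^ (s - 1)) * ENNReal.ofReal ((V x + τ)⁻ ^ p)) hpair
  have h1 : ∀ τ : ℝ, ENNReal.ofReal (τ ^ (s - 1)) *
      (L * ∫⁻ x, ENNReal.ofReal ((V x + τ)⁻ ^ p)) =
      L * ∫⁻ x, ENNReal.ofReal (τ ^ (s - 1)) * ENNReal.ofReal ((V x + τ)⁻ ^ p) := fun τ => by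
    rw [lintegral_const_mul' _ _ ENNReal.ofReal_ne_top, mul_left_comm]
  simp only [h1]
  rw [lintegral_const_mul'' _ hpair.lintegral_prod_right', hswap,
    ← lintegral_const_mul' _ _ ENNReal.ofReal_ne_top]
  congr 1
  refine lintegral_congr fun x => ?_
  rw [← ENNReal.ofReal_mul (ProbabilityTheory.beta_pos hs (by linarith)).le, mul_comm (_ : ℝ),
    ← lintegral_rpow_mul_indicator hs hp.le (negPart_nonneg (V x))]
  refine setLIntegral_congr_fun measurableSet_Ioi fun τ hτ => ?_
  rw [ofReal_negPart_add_rpow hp (V x) hτ]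

/-- The comparison at each τ > 0 is integrated against τ^(s-1) dτ. -/
lemma sum_rpow_mul_beta_le {ι : Type*} [Fintype ι] {V : Space d → ℝ}
    (hV : AEStronglyMeasurable V volume) (u : ι → H1 d) (E : ι → ℝ)
    (hu : Orthonormal ℂ fun j => (u j : L2 d))
    (huE : ∀ j, (u j, (E j : ℂ) • (u j : L2 d)) ∈ schrodingerWeakGraph V)
    {γ s p : ℝ} (hγ : 0 ≤ γ) (hs : 0 < s) (hp : 0 < p)
    {q L : ℝ≥0∞} (hE : ∀ j, E j < 0) (hL : ∀ W : Space d → ℝ, MemLp W q volume →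
      eigenvalueSum γ W ≤ L * ∫⁻ x, ENNReal.ofReal ((W x)⁻ ^ p)) :
    (∑ j, ENNReal.ofReal (|E j| ^ (s + γ))) * ENNReal.ofReal (ProbabilityTheory.beta s (γ + 1)) ≤
      L * (ENNReal.ofReal (ProbabilityTheory.beta s (p + 1)) *
        ∫⁻ x, ENNReal.ofReal ((V x)⁻ ^ (s + p))) := by
  classical
  rw [← lintegral_lintegral_negPart_add hV hs hp, Finset.sum_mul]
  have h1 : ∀ j, ENNReal.ofReal (|E j| ^ (s + γ)) *
      ENNReal.ofReal (ProbabilityTheory.beta s (γ + 1)) =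
      ∫⁻ τ in Set.Ioi (0 : ℝ), ENNReal.ofReal (τ ^ (s - 1)) *
        (Set.Iio |E j|).indicator (fun τ => ENNReal.ofReal ((|E j| - τ) ^ γ)) τ := fun j => by
    rw [lintegral_rpow_mul_indicator hs hγ (abs_nonneg _), ENNReal.ofReal_mul (by positivity)]
  simp only [h1]
  rw [← lintegral_finsetSum' _ fun j _ => ?_]
  · refine setLIntegral_mono' measurableSet_Ioi fun τ hτ => ?_
    rw [← Finset.mul_sum]
    gcongr
    -- At fixed τ only the eigenvalues below -τ contribute, which the indicator records.
    have h2 := sum_shifted_rpow_le hV (fun j : {j // τ < |E j|} => u j) (fun j => E j)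
      (hu.comp _ Subtype.val_injective) (fun j => huE j) hτ
      (fun j => by
        have h3 := j.2
        rw [abs_of_neg (hE _)] at h3
        linarith) hγ hp.le hL
    refine le_trans (le_of_eq ?_) h2
    simp only [Set.indicator_apply, Set.mem_Iio]
    rw [← Finset.sum_filter]
    exact Finset.sum_subtype _ (fun j => by simp) _
  · refine AEMeasurable.mul (by fun_prop) ?_
    exact (Measurable.indicator (by fun_prop) measurableSet_Iio).aemeasurable

/-! ### Semiclassical constants and conclusion. -/

/-- Both sides reduce to Γ(s) Γ(γ+1) / ((4π)^(d/2) Γ(s+γ+d/2+1)). -/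
lemma beta_mul_classicalConstant {γ s : ℝ} (hγ : 0 ≤ γ) (hs : 0 < s) :
    ProbabilityTheory.beta s (γ + (d : ℝ) / 2 + 1) * classicalConstant γ d =
      classicalConstant (s + γ) d * ProbabilityTheory.beta s (γ + 1) := by
  have hd : (0 : ℝ) ≤ (d : ℝ) / 2 := by positivity
  have h1 := (Real.Gamma_pos_of_pos (by positivity : 0 < γ + 1)).ne'
  have h2 := (Real.Gamma_pos_of_pos (by positivity : 0 < γ + (d : ℝ) / 2 + 1)).ne'
  have h3 := (Real.Gamma_pos_of_pos (by positivity : 0 < s + γ + 1)).ne'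
  have h4 := (Real.Gamma_pos_of_pos (by positivity : 0 < s + γ + (d : ℝ) / 2 + 1)).ne'
  have h5 : ((4 * Real.pi) ^ ((d : ℝ) / 2) : ℝ) ≠ 0 := by positivity
  simp only [ProbabilityTheory.beta, classicalConstant,
    show s + (γ + (d : ℝ) / 2 + 1) = s + γ + (d : ℝ) / 2 + 1 by ring,
    show s + (γ + 1) = s + γ + 1 by ring]
  field_simp

lemma classicalConstant_pos {γ : ℝ} (hγ : 0 ≤ γ) (d : ℕ) : 0 < classicalConstant γ d := by
  have hd : (0 : ℝ) ≤ (d : ℝ) / 2 := by positivity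
  have h1 := Real.Gamma_pos_of_pos (by positivity : 0 < γ + 1)
  have h2 := Real.Gamma_pos_of_pos (by positivity : 0 < γ + (d : ℝ) / 2 + 1)
  rw [classicalConstant]
  positivity

/-- An admissible constant for the exponent `γ` gives one for the exponent `s + γ`. -/
lemma optimalConstant_le_of_mem {γ s : ℝ} (hγ : 0 ≤ γ) (hs : 0 < s) (hd : 1 ≤ d) {L : ℝ≥0∞}
    (hL : ∀ V : Space d → ℝ, MemLp V (ENNReal.ofReal (γ + (d : ℝ) / 2)) volume →
      eigenvalueSum γ V ≤ L * ∫⁻ x, ENNReal.ofReal ((V x)⁻ ^ (γ + (d : ℝ) / 2))) :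
    optimalConstant (s + γ) d ≤ L * (ENNReal.ofReal (classicalConstant (s + γ) d) /
      ENNReal.ofReal (classicalConstant γ d)) := by
  refine sInf_le fun V hV => eigenvalueSum_le fun ι _ u E hu hE huE => ?_
  have hd' : (0 : ℝ) < (d : ℝ) / 2 := by
    have : (0 : ℝ) < d := by exact_mod_cast hd
    positivity
  have h := sum_rpow_mul_beta_le hV.1 u E hu huE hγ hs (by linarith : 0 < γ + (d : ℝ) / 2) hE hL
  have hb : 0 < ProbabilityTheory.beta s (γ + 1) := ProbabilityTheory.beta_pos hs (by linarith)
  have hc := classicalConstant_pos hγ d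
  have hratio : ENNReal.ofReal (classicalConstant (s + γ) d) /
      ENNReal.ofReal (classicalConstant γ d) =
      ENNReal.ofReal (ProbabilityTheory.beta s (γ + (d : ℝ) / 2 + 1)) /
        ENNReal.ofReal (ProbabilityTheory.beta s (γ + 1)) := by
    rw [← ENNReal.ofReal_div_of_pos hc, ← ENNReal.ofReal_div_of_pos hb]
    congr 1
    rw [div_eq_div_iff hc.ne' hb.ne', ← beta_mul_classicalConstant hγ hs]
  have hb0 : ENNReal.ofReal (ProbabilityTheory.beta s (γ + 1)) ≠ 0 := by simpa using hb
  rw [hratio, add_assoc s γ]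
  rw [← ENNReal.le_div_iff_mul_le (Or.inl hb0) (Or.inl ENNReal.ofReal_ne_top)] at h
  refine h.trans (le_of_eq ?_)
  rw [mul_div_assoc, mul_assoc L, ENNReal.mul_div_right_comm]

end LiebThirring

end

theorem mainTheorem5 (d : ℕ) (γ γ' : ℝ) (hγ : LiebThirring.Admissible γ d) (hγ' : γ ≤ γ') :
    LiebThirring.ratio γ' d ≤ LiebThirring.ratio γ d := by
  obtain ⟨hd, hγ0, -, -⟩ := hγ
  -- The Beta integral needs s = γ' - γ > 0.
  rcases hγ'.eq_or_lt with rfl | hlt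
  · exact le_rfl
  have hc := LiebThirring.classicalConstant_pos hγ0 d
  have hc' := LiebThirring.classicalConstant_pos (hγ0.trans hγ') d
  set c := ENNReal.ofReal (LiebThirring.classicalConstant γ d) with hcdef
  set c' := ENNReal.ofReal (LiebThirring.classicalConstant γ' d) with hcdef'
  have hc0 : c ≠ 0 := by simpa [hcdef] using hc
  have hc0' : c' ≠ 0 := by simpa [hcdef'] using hc'
  have hct : c ≠ ∞ := ENNReal.ofReal_ne_top
  have hct' : c' ≠ ∞ := ENNReal.ofReal_ne_top
  rw [LiebThirring.ratio, LiebThirring.ratio, ENNReal.le_div_iff_mul_le (Or.inl hc0) (Or.inl hct)]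
  refine le_sInf fun L hL => ?_
  have h := LiebThirring.optimalConstant_le_of_mem hγ0 (sub_pos.2 hlt) hd hL
  rw [sub_add_cancel, ← hcdef, ← hcdef'] at h
  calc LiebThirring.optimalConstant γ' d / c' * c ≤ L * (c' / c) / c' * c := by gcongr
    _ = L * (c' * c'⁻¹) * (c * c⁻¹) := by
      simp only [div_eq_mul_inv]; ac_rfl
    _ = L := by rw [ENNReal.mul_inv_cancel hc0' hct', ENNReal.mul_inv_cancel hc0 hct]; simp
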